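/- Let $X$ be a real separable Hilbert space and $\Delta=\{(s,t)\in\mathbb R^2: s<t\}$. Assume: 1. $\{U(t,s)\}_{s\le t}\subseteq\mathcal L(X)$ satisfies $U(t,t)=I$, $U(t,r)U(r,s)=U(t,s)$ for $s\le r\le t$, the map $(s,t)\mapsto U(t,s)x$ is continuous on $\{s\le t\}$ for every $x\in X$, and $\|U(t,s)\|\le Me^{-\zeta(t-s)}$ for some $M>0$, $\zeta\in\mathbb R$ and all $s\le t$. 2. $\{B(t)\}_{t\in\mathbb R}\subseteq\mathcal L(X)$ is bounded in operator norm and $t\mapsto B(t)x$ is continuous for every $x\in X$. Put $Q(r)=B(r)B(r)^\star$, $Q(t,s)x=\int_s^tU(t,r)Q(r)U(t,r)^\star x\,dr$ for $s<t$, and $Q(t,-\infty)x=\int_{-\infty}^tU(t,r)Q(r)U(t,r)^\star x\,dr$. Each $Q(t,s)$ has finite trace and $\sup_{s<t}\operatorname{Tr}Q(t,s)<+\infty$ for every $t\in\mathbb R$. 3. There are linear operators $A(r):D(A(r))\subseteq X\to X$, $r\in\mathbb R$, such that $D(A(r))$ and $D(A(r)^\star)$ are dense in $X$ and, for all $s<t$,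 $U(t,s)D(A(s))\subseteq D(A(t))$, $U(t,s)^\star D(A(t)^\star)\subseteq D(A(s)^\star)$, and $\partial_sU(t,s)x=-U(t,s)A(s)x$, $\partial_tU(t,s)x=A(t)U(t,s)x$ for every $x\in D(A(s))$. 4. $\lim_{s\to-\infty}U(t,s)x=0$ for all $t\in\mathbb R$, $x\in X$. For $r\in\mathbb R$ let $H_r=Q(r)^{1/2}(X)$ with the norm $\|y\|_{H_r}=\|x\|_X$, where $x$ is the unique element of $(\ker Q(r)^{1/2})^\perp$ with $Q(r)^{1/2}x=y$. Assume also that $U(t,s)H_s\subseteq H_t$ for all $s<t$ and that there are $C,\eta>0$ and $\alpha\in[0,\tfrac12)$ with $$\|U(t,s)\|_{\mathcal L(H_s;H_t)}\le C\,\frac{e^{-\eta(t-s)}}{(t-s)^\alpha},\qquad s<t.$$ Then for every $t\in\mathbb R$ the Gaussian measure $\gamma_t$ on $X$ with mean $0$ and covariance operator $Q(t,-\infty)$ exists, and for all $\varphi\in C^1_b(X)$ (bounded, continuously Fréchet differentiable, with bounded derivative), $t\in\mathbb R$ and $p\in(1,+\infty)$, with $m_t(\psi)=\int_X\psi\,d\gamma_t$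 and $0\log0=0$, the functions $|\varphi|^p$ and $|\varphi|^p\log|\varphi|^p$ are $\gamma_t$-integrable and $$\int_X|\varphi|^p\log(|\varphi|^p)\,d\gamma_t-m_t(|\varphi|^p)\log\big(m_t(|\varphi|^p)\big)\le\kappa\,p^2\int_X|\varphi|^{p-2}\,\|Q(t)^{1/2}\nabla\varphi\|_X^2\,\mathbf 1_{\{\varphi\ne0\}}\,d\gamma_t,$$ where $$\kappa=\frac{C^2}{2}\,(2\eta)^{2\alpha-1}\,\Gamma(1-2\alpha),$$ and the right-hand side is allowed to be $+\infty$. -/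

import Mathlib

open MeasureTheory Set Filter Topology
open scoped ENNReal

namespace OUEvol

noncomputable section

/-! Real separable Hilbert space: positive square roots, pseudo-inverses, traces, Gaussian measures -/

/-- The non-negative self-adjoint square root of a non-negative self-adjoint bounded operator `Q`
on a real Hilbert space: the (unique) `R` that is self-adjoint, non-negative and has `R ∘ R = Q`. -/
def posSqrt {X : Type*} [NormedAddCommGroup X] [InnerProductSpace ℝ X]
    (Q : X →L[ℝ] X) : X →L[ℝ] X :=
  Classical.epsilon fun R : X →L[ℝ] X => R.IsPositive ∧ R ∘L R = Q

open Classical in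
/-- The pseudo-inverse of a bounded operator `R`: for `y` in the range of `R`, the unique
`x` in the orthogonal complement of `ker R` with `R x = y` (and `0` outside the range). -/
def pseudoInv {X : Type*} [NormedAddCommGroup X] [InnerProductSpace ℝ X]
    (R : X →L[ℝ] X) (y : X) : X :=
  if h : ∃ x : X, (∀ z : X, R z = 0 → inner ℝ z x = 0) ∧ R x = y then h.choose else 0

/-- The norm `‖y‖ = ‖R⁻¹ y‖` of the Hilbert space `H_R = R(X)`. It is meant for `y ∈ R(X)`. -/
def rangeNorm {X : Type*} [NormedAddCommGroup X] [InnerProductSpace ℝ X]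
    (R : X →L[ℝ] X) (y : X) : ℝ :=
  ‖pseudoInv R y‖

/-- The index set of a fixed orthonormal (Hilbert) basis of `X`. -/
def basisIndex (X : Type*) [NormedAddCommGroup X] [InnerProductSpace ℝ X] [CompleteSpace X] :
    Set X :=
  (exists_hilbertBasis ℝ X).choose

/-- A fixed orthonormal (Hilbert) basis of `X`. -/
def basis (X : Type*) [NormedAddCommGroup X] [InnerProductSpace ℝ X] [CompleteSpace X] :
    HilbertBasis (basisIndex X) ℝ X :=
  (exists_hilbertBasis ℝ X).choose_spec.choose

/-- The trace `∑ₙ ⟨T eₙ, eₙ⟩ ∈ [0, ∞]` of a non-negative self-adjoint operator `T`; its value does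
not depend on the orthonormal basis. -/
def opTrace {X : Type*} [NormedAddCommGroup X] [InnerProductSpace ℝ X] [CompleteSpace X]
    (T : X → X) : ℝ≥0∞ :=
  ∑' i : basisIndex X, ENNReal.ofReal (inner ℝ (T (basis X i)) (basis X i))

/-- `μ` is the Gaussian measure with mean `m` and covariance operator `Q`: the Borel probability
measure with characteristic function `h ↦ exp (i ⟨m, h⟩ - ⟨Q h, h⟩ / 2)`. A measure is determined by
its characteristic function, so there is at most one such `μ`. -/
def IsGaussianMeasure {X : Type*} [NormedAddCommGroup X] [InnerProductSpace ℝ X]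
    [MeasurableSpace X] (m : X) (Q : X → X) (μ : Measure X) : Prop :=
  IsProbabilityMeasure μ ∧
    ∀ h : X, charFun μ h =
      Complex.exp (((inner ℝ m h : ℝ) : ℂ) * Complex.I - ((inner ℝ (Q h) h : ℝ) : ℂ) / 2)

/-- `C¹_b(X)`: bounded, continuously Fréchet differentiable, with bounded derivative. -/
structure IsC1b {X : Type*} [NormedAddCommGroup X] [InnerProductSpace ℝ X] (φ : X → ℝ) :
    Prop where
  contDiff : ContDiff ℝ 1 φ
  bounded : ∃ M : ℝ, ∀ x, |φ x| ≤ M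
  bounded_deriv : ∃ M : ℝ, ∀ x, ‖fderiv ℝ φ x‖ ≤ M

/-! The evolution operator, its diffusion coefficients and its covariance operators -/

section Evolution

variable {X : Type*} [NormedAddCommGroup X] [InnerProductSpace ℝ X] [CompleteSpace X]

/-- `Q(r) = B(r) B(r)⋆`. -/
def diffusion (B : ℝ → X →L[ℝ] X) (r : ℝ) : X →L[ℝ] X :=
  B r ∘L ContinuousLinearMap.adjoint (B r)

/-- `Q(r)^{1/2}`. -/
def sqrtDiffusion (B : ℝ → X →L[ℝ] X) (r : ℝ) : X →L[ℝ] X :=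
  posSqrt (diffusion B r)

/-- `Q(t,s) x = ∫_s^t U(t,r) Q(r) U(t,r)⋆ x dr` for `s ≤ t`. -/
def cov (U : ℝ → ℝ → X →L[ℝ] X) (B : ℝ → X →L[ℝ] X) (t s : ℝ) (x : X) : X :=
  ∫ r in Ioc s t, U t r (diffusion B r (ContinuousLinearMap.adjoint (U t r) x))

/-- `Q(t,-∞) x = ∫_{-∞}^t U(t,r) Q(r) U(t,r)⋆ x dr`. -/
def covInf (U : ℝ → ℝ → X →L[ℝ] X) (B : ℝ → X →L[ℝ] X) (t : ℝ) (x : X) : X :=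
  ∫ r in Iic t, U t r (diffusion B r (ContinuousLinearMap.adjoint (U t r) x))

/-- `(U(t,s))_{s ≤ t}` is a strongly continuous, exponentially bounded evolution operator. Only the
values `U t s` with `s ≤ t` are constrained. -/
structure IsEvolutionOperator (U : ℝ → ℝ → X →L[ℝ] X) : Prop where
  strongly_continuous : ∀ x : X,
    ContinuousOn (fun q : ℝ × ℝ => U q.2 q.1 x) {q : ℝ × ℝ | q.1 ≤ q.2}
  refl : ∀ t : ℝ, U t t = ContinuousLinearMap.id ℝ X
  comp : ∀ s r t : ℝ, s ≤ r → r ≤ t → U t r ∘L U r s = U t s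
  exp_bound : ∃ M ζ : ℝ, 0 < M ∧ ∀ s t : ℝ, s ≤ t → ‖U t s‖ ≤ M * Real.exp (-ζ * (t - s))

/-- `(B(t))` is a bounded and strongly continuous family of bounded operators. -/
structure IsBoundedStronglyContinuous (B : ℝ → X →L[ℝ] X) : Prop where
  bounded : ∃ K : ℝ, 0 < K ∧ ∀ t : ℝ, ‖B t‖ ≤ K
  strongly_continuous : ∀ x : X, Continuous fun t : ℝ => B t x

/-- The (possibly unbounded) operators `A(r) : D(A(r)) ⊆ X → X` are associated with the evolution
operator `U`. -/
structure IsAssociated (U : ℝ → ℝ → X →L[ℝ] X) (A : ℝ → X →ₗ.[ℝ] X) : Prop where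
  dense_domain : ∀ r : ℝ, Dense ((A r).domain : Set X)
  dense_adjoint_domain : ∀ r : ℝ, Dense ((A r).adjoint.domain : Set X)
  map_domain : ∀ s t : ℝ, s < t → ∀ x ∈ (A s).domain, U t s x ∈ (A t).domain
  map_adjoint_domain : ∀ s t : ℝ, s < t → ∀ x ∈ (A t).adjoint.domain,
    ContinuousLinearMap.adjoint (U t s) x ∈ (A s).adjoint.domain
  deriv_left : ∀ (s t : ℝ), s < t → ∀ x : (A s).domain,
    HasDerivAt (fun σ : ℝ => U t σ (x : X)) (-(U t s (A s x))) s
  deriv_right : ∀ (s t : ℝ) (hst : s < t) (x : (A s).domain),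
    HasDerivAt (fun τ : ℝ => U τ s (x : X)) (A t ⟨U t s x, map_domain s t hst x x.2⟩) t

/-- The standing assumptions on `U`, `B`, `A`: the evolution operator and its coefficients, the
trace bounds on `Q(t,s)`, and the decay of `U(t,s)x` as `s → -∞`. -/
structure StandingAssumptions (U : ℝ → ℝ → X →L[ℝ] X) (B : ℝ → X →L[ℝ] X)
    (A : ℝ → X →ₗ.[ℝ] X) : Prop where
  evolution : IsEvolutionOperator U
  coeff : IsBoundedStronglyContinuous B
  trace_finite : ∀ s t : ℝ, s < t → opTrace (cov U B t s) < ∞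
  associated : IsAssociated U A
  trace_bound : ∀ t : ℝ, (⨆ s : Iio t, opTrace (cov U B t s)) < ∞
  decay : ∀ (t : ℝ) (x : X), Tendsto (fun s : ℝ => U t s x) atBot (𝓝 0)

/-- `U(t,s) H_s ⊆ H_t` and `‖U(t,s)‖_{L(H_s; H_t)} ≤ K`, where `H_r` is the range of
`Q(r)^{1/2}` with its norm. -/
def MapsRangeWithNormLE (U : ℝ → ℝ → X →L[ℝ] X) (B : ℝ → X →L[ℝ] X) (s t K : ℝ) : Prop :=
  ∀ y ∈ range (sqrtDiffusion B s),
    U t s y ∈ range (sqrtDiffusion B t) ∧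
      rangeNorm (sqrtDiffusion B t) (U t s y) ≤ K * rangeNorm (sqrtDiffusion B s) y

end Evolution

end

end OUEvol

/-!
Everything reduces to the Gaussian logarithmic Sobolev inequality on a Hilbert space,
`Ent (f) ≤ (1/2) ∫ ⟨Q(t,-∞) ∇f, ∇f⟩ / f dγ_t`, and to the comparison of `Q(t,-∞)` with `Q(t)`.

*The comparison.* Dualising the bound on `U(t,r) : H_r → H_t` gives
`‖Q(r)^{1/2} U(t,r)⋆ x‖ ≤ K(t - r) ‖Q(t)^{1/2} x‖` (`norm_backwardNoise_le`). Squaring and integrating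
in `r`, the Gamma integral `∫ K² = C² (2η)^{2α-1} Γ(1-2α)` (`integral_kernel_sq`) shows that the
integral defining `Q(t,-∞)` converges and that `⟨Q(t,-∞) x, x⟩ ≤ 2κ ‖Q(t)^{1/2} x‖²`
(`exists_covInf_operator`). The uniform trace bounds make `Q(t,-∞)` trace class
(`summable_inner_covInf`).

*The measure.* With `R` the positive square root of `Q(t,-∞)` (`exists_sqrt`) and `(eᵢ)` a Hilbert
basis, the series `∑ gᵢ R eᵢ` with independent standard Gaussians `gᵢ` converges in `L²`, and `γ_t`
is the law of its sum (`exists_gaussian_logSobolev`).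

*The logarithmic Sobolev inequality.* On the line it follows from the monotone transport `T` of
`f ρ` to the Gaussian weight `ρ`: with `θ = T - x`, the change of variables formula and
`log T' ≤ T' - 1` yield `f log f ρ ≤ (θ f ρ)' + f'² / (2 f) ρ`. On `[-L, L]` the map `T` fixes the end
points, so that the derivative integrates to zero (`logSobolev_interval_of_mean_one`), and
`L → ∞` gives the Gaussian case (`logSobolev_gaussianReal`). Independent Gaussian summands are then
added one at a time, since averaging along one direction does not increase the Fisher information
in the others (`HasLogSobolev.insert_direction`), and the inequality passes to the limit of the
series.

*Powers.* The inequality is applied to `f = |φ|^p + ε`, which is `C¹` because `p > 1` and bounded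
below by `ε > 0`; its energy density is at most `p² |φ|^{p-2} ‖Q(t)^{1/2} ∇φ‖²` on `{φ ≠ 0}` and
vanishes elsewhere (`IsC1b.energy_abs_rpow_add_le`), uniformly in `ε`.
-/

namespace OUEvol

/-! ### The logarithmic Sobolev inequality on the real line -/

/-- The Gaussian weight, frozen at its value at `±L` outside `[-L, L]`, so that its primitive is a
bijection of the line. -/
noncomputable def truncWeight (L x : ℝ) : ℝ := Real.exp (-(min (x ^ 2) (L ^ 2)) / 2)

lemma continuous_truncWeight (L : ℝ) : Continuous (truncWeight L) := by
  unfold truncWeight; fun_prop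

lemma truncWeight_pos (L x : ℝ) : 0 < truncWeight L x := Real.exp_pos _

lemma truncWeight_of_mem {L x : ℝ} (hx : x ∈ Icc (-L) L) :
    truncWeight L x = Real.exp (-x ^ 2 / 2) := by
  have : x ^ 2 ≤ L ^ 2 := sq_le_sq' hx.1 hx.2
  rw [truncWeight, min_eq_left this]

lemma hasDerivAt_primitive {g : ℝ → ℝ} (hg : Continuous g) (a x : ℝ) :
    HasDerivAt (fun y => ∫ u in a..y, g u) (g x) x :=
  intervalIntegral.integral_hasDerivAt_right (hg.intervalIntegrable _ _)
    (hg.stronglyMeasurableAtFilter _ _) hg.continuousAt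

/-- The monotone transport of `g` to `w` on `[-L, L]`, for positive densities of equal mass. -/
lemma exists_transport {L : ℝ} {w g : ℝ → ℝ} (hw : Continuous w) (hg : Continuous g)
    {c : ℝ} (hc : 0 < c) (hwc : ∀ x, c ≤ w x) (hgpos : ∀ x, 0 < g x)
    (hmass : ∫ x in (-L)..L, g x = ∫ x in (-L)..L, w x) :
    ∃ T : ℝ → ℝ, T (-L) = -L ∧ T L = L ∧ (∀ x ∈ Icc (-L) L, T x ∈ Icc (-L) L) ∧
      ∀ x, HasDerivAt T (g x / w (T x)) x := by
  set G : ℝ → ℝ := fun y => ∫ u in (-L)..y, w u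
  set F : ℝ → ℝ := fun y => ∫ u in (-L)..y, g u
  have hG : ∀ x, HasDerivAt G (w x) x := hasDerivAt_primitive hw _
  have hF : ∀ x, HasDerivAt F (g x) x := hasDerivAt_primitive hg _
  have hGmono : StrictMono G := strictMono_of_deriv_pos fun x => by
    rw [(hG x).deriv]; exact hc.trans_le (hwc x)
  have hFmono : StrictMono F := strictMono_of_deriv_pos fun x => by
    rw [(hF x).deriv]; exact hgpos x
  have hGcont : Continuous G := continuous_iff_continuousAt.2 fun x => (hG x).continuousAt
  have hG0 : G (-L) = 0 := intervalIntegral.integral_same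
  have hF0 : F (-L) = 0 := intervalIntegral.integral_same
  -- `G y - c y` is monotone, which forces `G` to be onto.
  have hmon : Monotone fun y => G y - c * y := by
    apply monotone_of_deriv_nonneg
    · exact fun x => ((hG x).sub ((hasDerivAt_id x).const_mul c)).differentiableAt
    · intro x
      have : HasDerivAt (fun y => G y - c * y) (w x - c * 1) x :=
        (hG x).sub ((hasDerivAt_id x).const_mul c)
      rw [this.deriv]; linarith [hwc x]
  have htop : Tendsto G atTop atTop := by
    refine tendsto_atTop_mono' atTop (f₁ := fun y => c * y + G 0) ?_
      (tendsto_atTop_add_const_right _ _ (tendsto_id.const_mul_atTop hc))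
    filter_upwards [eventually_ge_atTop 0] with y hy
    have := hmon hy
    simp only at this; linarith
  have hbot : Tendsto G atBot atBot := by
    refine tendsto_atBot_mono' atBot (f₁ := fun y => c * y + G 0) ?_
      (tendsto_atBot_add_const_right _ _ (tendsto_id.const_mul_atBot hc))
    filter_upwards [eventually_le_atBot 0] with y hy
    have := hmon hy
    simp only at this; linarith
  let e : ℝ ≃o ℝ := hGmono.orderIsoOfSurjective G (hGcont.surjective htop hbot)
  have heG : ∀ y, e y = G y := fun y => rfl
  have hes : ∀ y, e.symm (G y) = y := fun y => by rw [← heG]; exact e.symm_apply_apply y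
  have hGe : ∀ y, G (e.symm y) = y := fun y => by rw [← heG]; exact e.apply_symm_apply y
  have hT1 : e.symm (F (-L)) = -L := by rw [hF0, ← hG0, hes]
  have hT2 : e.symm (F L) = L := by
    have : F L = G L := hmass
    rw [this, hes]
  refine ⟨fun x => e.symm (F x), hT1, hT2, ?_, ?_⟩
  · intro x hx
    refine ⟨?_, ?_⟩
    · rw [← hT1]; exact e.symm.monotone (hFmono.monotone hx.1)
    · rw [← hT2]; exact e.symm.monotone (hFmono.monotone hx.2)
  · intro x
    have h1 : HasDerivAt e.symm (w (e.symm (F x)))⁻¹ (F x) :=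
      HasDerivAt.of_local_left_inverse e.symm.continuous.continuousAt (hG _)
        (hc.trans_le (hwc _)).ne' (Eventually.of_forall hGe)
    have := h1.comp x (hF x)
    rwa [inv_mul_eq_div] at this

/-- The logarithmic Sobolev inequality for the Gaussian restricted to `[-L, L]` and a density `f`
of mean one: the transport map fixes `±L`, so that the integration by parts has no boundary
terms. -/
lemma logSobolev_interval_of_mean_one {L : ℝ} (hL : 0 ≤ L) {f f' : ℝ → ℝ}
    (hf : ∀ x, HasDerivAt f (f' x) x) (hf' : Continuous f') (hpos : ∀ x, 0 < f x)
    (hmass : ∫ x in (-L)..L, f x * Real.exp (-x ^ 2 / 2) = ∫ x in (-L)..L, Real.exp (-x ^ 2 / 2)) :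
    ∫ x in (-L)..L, f x * Real.log (f x) * Real.exp (-x ^ 2 / 2) ≤
      (1 / 2) * ∫ x in (-L)..L, f' x ^ 2 / f x * Real.exp (-x ^ 2 / 2) := by
  have hfc : Continuous f := continuous_iff_continuousAt.2 fun x => (hf x).continuousAt
  have hLL : -L ≤ L := by linarith
  set w := truncWeight L
  have hw := continuous_truncWeight L
  obtain ⟨T, hT1, hT2, hTm, hTd⟩ := exists_transport (L := L) (w := w) (g := fun x => f x * w x)
    hw (hfc.mul hw) (c := Real.exp (-(L ^ 2) / 2)) (Real.exp_pos _)
    (fun x => Real.exp_le_exp.2 (by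
      have := min_le_right (x ^ 2) (L ^ 2); linarith))
    (fun x => mul_pos (hpos x) (truncWeight_pos _ _)) (by
      rw [intervalIntegral.integral_congr (g := fun x => f x * Real.exp (-x ^ 2 / 2)),
        intervalIntegral.integral_congr (f := w) (g := fun x => Real.exp (-x ^ 2 / 2)), hmass]
      · intro x hx
        rw [uIcc_of_le hLL] at hx
        exact truncWeight_of_mem hx
      · intro x hx
        rw [uIcc_of_le hLL] at hx
        simp only [w, truncWeight_of_mem hx])
  have hTc : Continuous T := continuous_iff_continuousAt.2 fun x => (hTd x).continuousAt
  set ρ : ℝ → ℝ := fun x => Real.exp (-x ^ 2 / 2)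
  have hρc : Continuous ρ := by fun_prop
  have hρd : ∀ x, HasDerivAt ρ (-x * ρ x) x := fun x => by
    have h : HasDerivAt (fun x : ℝ => -x ^ 2 / 2) (-x) x := by
      convert! ((hasDerivAt_pow 2 x).neg.div_const 2) using 1
      simp only [Nat.cast_ofNat, Nat.add_one_sub_one, pow_one]; ring
    convert! h.exp using 1
    ring
  set T' : ℝ → ℝ := fun x => f x * w x / w (T x)
  have hT'c : Continuous T' :=
    (hfc.mul hw).div (hw.comp hTc) fun x => (truncWeight_pos _ _).ne'
  set D : ℝ → ℝ := fun x =>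
    ((T' x - 1) * f x + (T x - x) * f' x) * ρ x + (T x - x) * f x * (-x * ρ x)
  have hDc : Continuous D := by fun_prop
  have hDd : ∀ x, HasDerivAt (fun x => (T x - x) * f x * ρ x) (D x) x := fun x =>
    (((hTd x).sub (hasDerivAt_id x)).mul (hf x)).mul (hρd x)
  have hD0 : ∫ x in (-L)..L, D x = 0 := by
    rw [intervalIntegral.integral_eq_sub_of_hasDerivAt (fun x _ => hDd x)
      (hDc.intervalIntegrable _ _)]
    simp [hT1, hT2]
  have key : ∀ x ∈ Icc (-L) L,
      f x * Real.log (f x) * ρ x ≤ D x + (1 / 2) * (f' x ^ 2 / f x * ρ x) := by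
    intro x hx
    have hρ : 0 < ρ x := Real.exp_pos _
    have hfx := hpos x
    have hT'pos : 0 < T' x :=
      div_pos (mul_pos (hpos x) (truncWeight_pos _ _)) (truncWeight_pos _ _)
    have hT'eq : T' x = f x * Real.exp (-x ^ 2 / 2) / Real.exp (-(T x) ^ 2 / 2) := by
      simp only [T', w, truncWeight_of_mem hx, truncWeight_of_mem (hTm x hx)]
    have hlog : Real.log (T' x) = Real.log (f x) - x ^ 2 / 2 + T x ^ 2 / 2 := by
      rw [hT'eq, Real.log_div (by positivity) (by positivity), Real.log_mul hfx.ne' (by positivity),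
        Real.log_exp, Real.log_exp]
      ring
    have h1 := Real.log_le_sub_one_of_pos hT'pos
    -- the pointwise Young inequality `-θ f' - f θ² / 2 ≤ f'² / (2 f)`
    have h2 : -(T x - x) * f' x - f x * (T x - x) ^ 2 / 2 ≤ (1 / 2) * (f' x ^ 2 / f x) := by
      have : (1 / 2) * (f' x ^ 2 / f x) - (-(T x - x) * f' x - f x * (T x - x) ^ 2 / 2) =
          (f' x + f x * (T x - x)) ^ 2 / (2 * f x) := by field_simp; ring
      have h3 : 0 ≤ (f' x + f x * (T x - x)) ^ 2 / (2 * f x) := by positivity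
      linarith
    have h4 : f x * Real.log (f x) ≤
        (T' x - 1) * f x + (T x - x) * f' x - (T x - x) * f x * x + (1 / 2) * (f' x ^ 2 / f x) := by
      have h5 : Real.log (f x) ≤ T' x - 1 + x ^ 2 / 2 - T x ^ 2 / 2 := by linarith
      have h6 := mul_le_mul_of_nonneg_left h5 hfx.le
      nlinarith
    have := mul_le_mul_of_nonneg_right h4 hρ.le
    simp only [D]
    linarith
  have hi1 : Continuous fun x => f x * Real.log (f x) * ρ x :=
    (hfc.mul (hfc.log fun x => (hpos x).ne')).mul hρc
  have hi2 : Continuous fun x => f' x ^ 2 / f x * ρ x :=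
    ((hf'.pow 2).div hfc fun x => (hpos x).ne').mul hρc
  calc ∫ x in (-L)..L, f x * Real.log (f x) * ρ x
      ≤ ∫ x in (-L)..L, (D x + (1 / 2) * (f' x ^ 2 / f x * ρ x)) :=
        intervalIntegral.integral_mono_on hLL (hi1.intervalIntegrable _ _)
          ((hDc.add (hi2.const_mul _)).intervalIntegrable _ _) key
    _ = (1 / 2) * ∫ x in (-L)..L, f' x ^ 2 / f x * ρ x := by
        rw [intervalIntegral.integral_add (hDc.intervalIntegrable _ _)
          ((hi2.const_mul _).intervalIntegrable _ _), hD0, intervalIntegral.integral_const_mul,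
          zero_add]

lemma logSobolev_interval {L : ℝ} (hL : 0 < L) {f f' : ℝ → ℝ}
    (hf : ∀ x, HasDerivAt f (f' x) x) (hf' : Continuous f') (hpos : ∀ x, 0 < f x) :
    (∫ x in (-L)..L, f x * Real.log (f x) * Real.exp (-x ^ 2 / 2)) -
      (∫ x in (-L)..L, f x * Real.exp (-x ^ 2 / 2)) *
        Real.log ((∫ x in (-L)..L, f x * Real.exp (-x ^ 2 / 2)) /
          ∫ x in (-L)..L, Real.exp (-x ^ 2 / 2)) ≤
      (1 / 2) * ∫ x in (-L)..L, f' x ^ 2 / f x * Real.exp (-x ^ 2 / 2) := by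
  have hfc : Continuous f := continuous_iff_continuousAt.2 fun x => (hf x).continuousAt
  have hLL : -L < L := by linarith
  have hρc : Continuous fun x : ℝ => Real.exp (-x ^ 2 / 2) := by fun_prop
  set I := ∫ x in (-L)..L, f x * Real.exp (-x ^ 2 / 2)
  set Z := ∫ x in (-L)..L, Real.exp (-x ^ 2 / 2)
  have hI : 0 < I := intervalIntegral.intervalIntegral_pos_of_pos
    ((hfc.mul hρc).intervalIntegrable _ _) (fun x => mul_pos (hpos x) (Real.exp_pos _)) hLL
  have hZ : 0 < Z := intervalIntegral.intervalIntegral_pos_of_pos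
    (hρc.intervalIntegrable _ _) (fun x => Real.exp_pos _) hLL
  have ha : 0 < I / Z := div_pos hI hZ
  set a := I / Z with ha_def
  have h := logSobolev_interval_of_mean_one hL.le (f := fun x => f x / a) (f' := fun x => f' x / a)
    (fun x => (hf x).div_const a) (hf'.div_const a) (fun x => div_pos (hpos x) ha) (by
      have : ∀ x, f x / a * Real.exp (-x ^ 2 / 2) = a⁻¹ * (f x * Real.exp (-x ^ 2 / 2)) :=
        fun x => by ring
      simp only [this, intervalIntegral.integral_const_mul]
      change a⁻¹ * I = Z
      rw [ha_def]; field_simp)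
  have e1 : ∀ x, f x / a * Real.log (f x / a) * Real.exp (-x ^ 2 / 2) =
      a⁻¹ * (f x * Real.log (f x) * Real.exp (-x ^ 2 / 2) -
        Real.log a * (f x * Real.exp (-x ^ 2 / 2))) := fun x => by
    rw [Real.log_div (hpos x).ne' ha.ne']; ring
  have e2 : ∀ x, (f' x / a) ^ 2 / (f x / a) * Real.exp (-x ^ 2 / 2) =
      a⁻¹ * (f' x ^ 2 / f x * Real.exp (-x ^ 2 / 2)) := fun x => by
    have := (hpos x).ne'
    field_simp
  simp only [e1, e2, intervalIntegral.integral_const_mul] at h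
  rw [intervalIntegral.integral_sub, intervalIntegral.integral_const_mul] at h
  · have h' : a⁻¹ * ((∫ x in (-L)..L, f x * Real.log (f x) * Real.exp (-x ^ 2 / 2)) -
        Real.log a * I) ≤ a⁻¹ * (1 / 2 * ∫ x in (-L)..L, f' x ^ 2 / f x * Real.exp (-x ^ 2 / 2)) := by
      linarith
    have := le_of_mul_le_mul_left h' (inv_pos.2 ha)
    linarith
  · exact ((hfc.mul (hfc.log fun x => (hpos x).ne')).mul hρc).intervalIntegrable _ _
  · exact ((hfc.mul hρc).const_mul _).intervalIntegrable _ _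

lemma integral_gaussianReal_eq (g : ℝ → ℝ) :
    ∫ x, g x ∂(ProbabilityTheory.gaussianReal 0 1) =
      (√(2 * Real.pi))⁻¹ * ∫ x, g x * Real.exp (-x ^ 2 / 2) := by
  rw [ProbabilityTheory.integral_gaussianReal_eq_integral_smul one_ne_zero, ← integral_const_mul]
  congr 1 with x
  simp [ProbabilityTheory.gaussianPDFReal]
  ring

lemma integrable_exp_neg_sq_half : Integrable fun x : ℝ => Real.exp (-x ^ 2 / 2) := by
  have := integrable_exp_neg_mul_sq (b := 1 / 2) (by norm_num)
  refine this.congr (Eventually.of_forall fun x => ?_)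
  simp only; congr 1; ring

lemma integrable_mul_exp_neg_sq_half {g : ℝ → ℝ} (hg : Continuous g) {K : ℝ}
    (hK : ∀ x, |g x| ≤ K) : Integrable fun x : ℝ => g x * Real.exp (-x ^ 2 / 2) :=
  integrable_exp_neg_sq_half.bdd_mul hg.aestronglyMeasurable (Eventually.of_forall hK)

/-- A continuous function with values in `[c, C]`, `0 < c`, has a bounded `f log f`. -/
lemma exists_abs_mul_log_le {c C : ℝ} (hc : 0 < c) :
    ∃ K, ∀ y ∈ Icc c C, |y * Real.log y| ≤ K := by
  obtain ⟨K, hK⟩ := (isCompact_Icc (a := c) (b := C)).exists_bound_of_continuousOn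
    (f := fun y => y * Real.log y)
    (continuousOn_id.mul (Real.continuousOn_log.mono fun y hy => (hc.trans_le hy.1).ne'))
  exact ⟨K, hK⟩

/-- The logarithmic Sobolev inequality for the standard Gaussian on the line. -/
theorem logSobolev_gaussianReal {f f' : ℝ → ℝ} (hf : ∀ x, HasDerivAt f (f' x) x)
    (hf' : Continuous f') {c C K : ℝ} (hc : 0 < c) (hcf : ∀ x, c ≤ f x) (hfC : ∀ x, f x ≤ C)
    (hK : ∀ x, |f' x| ≤ K) :
    (∫ x, f x * Real.log (f x) ∂(ProbabilityTheory.gaussianReal 0 1)) -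
      (∫ x, f x ∂(ProbabilityTheory.gaussianReal 0 1)) *
        Real.log (∫ x, f x ∂(ProbabilityTheory.gaussianReal 0 1)) ≤
      (1 / 2) * ∫ x, f' x ^ 2 / f x ∂(ProbabilityTheory.gaussianReal 0 1) := by
  have hfc : Continuous f := continuous_iff_continuousAt.2 fun x => (hf x).continuousAt
  have hpos : ∀ x, 0 < f x := fun x => hc.trans_le (hcf x)
  obtain ⟨K', hK'⟩ := exists_abs_mul_log_le (C := C) hc
  have i1 : Integrable fun x => f x * Real.log (f x) * Real.exp (-x ^ 2 / 2) :=
    integrable_mul_exp_neg_sq_half (hfc.mul (hfc.log fun x => (hpos x).ne'))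
      (fun x => hK' _ ⟨hcf x, hfC x⟩)
  have i2 : Integrable fun x => f x * Real.exp (-x ^ 2 / 2) :=
    integrable_mul_exp_neg_sq_half hfc (K := C) fun x => by
      rw [abs_of_pos (hpos x)]; exact hfC x
  have i3 : Integrable fun x => f' x ^ 2 / f x * Real.exp (-x ^ 2 / 2) :=
    integrable_mul_exp_neg_sq_half ((hf'.pow 2).div hfc fun x => (hpos x).ne') (K := K ^ 2 / c)
      fun x => by
        rw [abs_of_nonneg (div_nonneg (sq_nonneg _) (hpos x).le)]
        exact div_le_div₀ (sq_nonneg _) (sq_le_sq' (neg_le_of_abs_le (hK x)) (le_of_abs_le (hK x)))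
          hc (hcf x)
  have lim : ∀ {g : ℝ → ℝ}, Integrable g →
      Tendsto (fun L : ℝ => ∫ x in (-L)..L, g x) atTop (𝓝 (∫ x, g x)) := fun hg =>
    intervalIntegral_tendsto_integral hg tendsto_neg_atTop_atBot tendsto_id
  have hZ : ∫ x : ℝ, Real.exp (-x ^ 2 / 2) = √(2 * Real.pi) := by
    have := integral_gaussian (1 / 2)
    rw [show Real.pi / (1 / 2) = 2 * Real.pi by ring] at this
    rw [← this]
    congr 1 with x; congr 1; ring
  have hs : 0 < √(2 * Real.pi) := by positivity
  simp only [integral_gaussianReal_eq]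
  set I := ∫ x, f x * Real.exp (-x ^ 2 / 2)
  have hI : 0 < I := by
    refine (integral_pos_iff_support_of_nonneg
      (fun x => (mul_pos (hpos x) (Real.exp_pos _)).le) i2).2 ?_
    have : Function.support (fun x => f x * Real.exp (-x ^ 2 / 2)) = univ :=
      eq_univ_of_forall fun x => (mul_pos (hpos x) (Real.exp_pos _)).ne'
    rw [this]; simp
  have hlim : (∫ x, f x * Real.log (f x) * Real.exp (-x ^ 2 / 2)) -
      I * Real.log (I / √(2 * Real.pi)) ≤
      (1 / 2) * ∫ x, f' x ^ 2 / f x * Real.exp (-x ^ 2 / 2) := by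
    refine le_of_tendsto_of_tendsto
      ((lim i1).sub ((lim i2).mul (((lim i2).div (hZ ▸ lim integrable_exp_neg_sq_half) hs.ne').log
        (div_pos hI hs).ne')))
      ((lim i3).const_mul _) ?_
    filter_upwards [eventually_gt_atTop 0] with L hL
    exact logSobolev_interval hL hf hf' hpos
  have := mul_le_mul_of_nonneg_left hlim (inv_pos.2 hs).le
  rw [inv_mul_eq_div _ I]
  rw [← inv_mul_eq_div] at this ⊢
  linarith

/-! ### The logarithmic Sobolev inequality for finite Gaussian sums -/

section GaussianSums

variable {X : Type*} [NormedAddCommGroup X] [InnerProductSpace ℝ X]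

/-- `C¹_b` functions bounded below by a positive constant: the densities for which the logarithmic
Sobolev inequality is written without any singularity. -/
structure IsC1bPos (f : X → ℝ) : Prop where
  contDiff : ContDiff ℝ 1 f
  lower : ∃ c, 0 < c ∧ ∀ x, c ≤ f x
  upper : ∃ C, ∀ x, f x ≤ C
  bounded_deriv : ∃ K, ∀ x, ‖fderiv ℝ f x‖ ≤ K

lemma IsC1bPos.continuous {f : X → ℝ} (hf : IsC1bPos f) : Continuous f := hf.contDiff.continuous

lemma IsC1bPos.pos {f : X → ℝ} (hf : IsC1bPos f) (x : X) : 0 < f x := by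
  obtain ⟨c, hc, h⟩ := hf.lower
  exact hc.trans_le (h x)

lemma IsC1bPos.continuous_fderiv {f : X → ℝ} (hf : IsC1bPos f) : Continuous (fderiv ℝ f) :=
  hf.contDiff.continuous_fderiv one_ne_zero

lemma IsC1bPos.hasFDerivAt {f : X → ℝ} (hf : IsC1bPos f) (x : X) :
    HasFDerivAt f (fderiv ℝ f x) x :=
  (hf.contDiff.differentiable one_ne_zero x).hasFDerivAt

lemma IsC1bPos.exists_abs_le {f : X → ℝ} (hf : IsC1bPos f) : ∃ C, ∀ x, |f x| ≤ C := by
  obtain ⟨C, h⟩ := hf.upper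
  exact ⟨C, fun x => by rw [abs_of_pos (hf.pos x)]; exact h x⟩

lemma IsC1bPos.continuous_mul_log {f : X → ℝ} (hf : IsC1bPos f) :
    Continuous fun x => f x * Real.log (f x) :=
  hf.continuous.mul (hf.continuous.log fun x => (hf.pos x).ne')

lemma IsC1bPos.exists_abs_mul_log_le {f : X → ℝ} (hf : IsC1bPos f) :
    ∃ K, ∀ x, |f x * Real.log (f x)| ≤ K := by
  obtain ⟨c, hc, h⟩ := hf.lower
  obtain ⟨C, h'⟩ := hf.upper
  obtain ⟨K, hK⟩ := OUEvol.exists_abs_mul_log_le (C := C) hc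
  exact ⟨K, fun x => hK _ ⟨h x, h' x⟩⟩

lemma IsC1bPos.continuous_sq_div {f : X → ℝ} (hf : IsC1bPos f) (v : X) :
    Continuous fun x => (fderiv ℝ f x v) ^ 2 / f x :=
  ((hf.continuous_fderiv.clm_apply continuous_const).pow 2).div hf.continuous
    fun x => (hf.pos x).ne'

lemma IsC1bPos.exists_abs_fderiv_apply_le {f : X → ℝ} (hf : IsC1bPos f) (v : X) :
    ∃ K, ∀ x, |fderiv ℝ f x v| ≤ K := by
  obtain ⟨K, h'⟩ := hf.bounded_deriv
  exact ⟨K * ‖v‖, fun x => ((fderiv ℝ f x).le_opNorm v).trans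
      (mul_le_mul_of_nonneg_right (h' x) (norm_nonneg _))⟩

lemma IsC1bPos.exists_abs_sq_div_le {f : X → ℝ} (hf : IsC1bPos f) (v : X) :
    ∃ K, ∀ x, |(fderiv ℝ f x v) ^ 2 / f x| ≤ K := by
  obtain ⟨c, hc, h⟩ := hf.lower
  obtain ⟨K, hK⟩ := hf.exists_abs_fderiv_apply_le v
  refine ⟨K ^ 2 / c, fun x => ?_⟩
  rw [abs_of_nonneg (div_nonneg (sq_nonneg _) (hf.pos x).le)]
  exact div_le_div₀ (sq_nonneg _)
    (sq_le_sq' (neg_le_of_abs_le (hK x)) (le_of_abs_le (hK x))) hc (h x)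

lemma integrable_of_continuous_of_bounded {Y : Type*} [TopologicalSpace Y] [MeasurableSpace Y]
    [OpensMeasurableSpace Y] {μ : Measure Y} [IsFiniteMeasure μ] {g : Y → ℝ} (hg : Continuous g)
    (hb : ∃ K, ∀ x, |g x| ≤ K) : Integrable g μ := by
  obtain ⟨K, hK⟩ := hb
  exact Integrable.of_bound hg.aestronglyMeasurable K (Eventually.of_forall hK)

/-- The average of `f` under the law of `x + g v`, where `g` is a standard real Gaussian. -/
noncomputable def gaussAvg (v : X) (f : X → ℝ) (x : X) : ℝ :=
  ∫ y, f (x + y • v) ∂(ProbabilityTheory.gaussianReal 0 1)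

lemma continuous_gaussAvg (v : X) {f : X → ℝ} (hf : Continuous f) (hb : ∃ K, ∀ x, |f x| ≤ K) :
    Continuous (gaussAvg v f) := by
  obtain ⟨K, hK⟩ := hb
  refine continuous_of_dominated (bound := fun _ => K) (fun x => ?_) (fun x => ?_)
    (integrable_const _) ?_
  · exact (show Continuous fun y : ℝ => f (x + y • v) by fun_prop).aestronglyMeasurable
  · exact Eventually.of_forall fun y => hK _
  · exact Eventually.of_forall fun y => by fun_prop

lemma exists_abs_gaussAvg_le (v : X) {f : X → ℝ} (hb : ∃ K, ∀ x, |f x| ≤ K) :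
    ∃ K, ∀ x, |gaussAvg v f x| ≤ K := by
  obtain ⟨K, hK⟩ := hb
  refine ⟨K, fun x => ?_⟩
  have := norm_integral_le_of_norm_le_const (μ := ProbabilityTheory.gaussianReal 0 1)
    (f := fun y : ℝ => f (x + y • v)) (Eventually.of_forall fun y => hK _)
  simpa [gaussAvg] using this

lemma IsC1bPos.hasFDerivAt_gaussAvg {f : X → ℝ} (hf : IsC1bPos f) (v x : X) :
    HasFDerivAt (gaussAvg v f)
      (∫ y, fderiv ℝ f (x + y • v) ∂(ProbabilityTheory.gaussianReal 0 1)) x := by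
  obtain ⟨K, hK⟩ := hf.bounded_deriv
  have hc := hf.continuous
  have hc' := hf.continuous_fderiv
  refine hasFDerivAt_integral_of_dominated_of_fderiv_le
    (F := fun x (y : ℝ) => f (x + y • v)) (F' := fun x (y : ℝ) => fderiv ℝ f (x + y • v))
    (bound := fun _ => K) univ_mem
    (Eventually.of_forall fun x => ?_) ?_ ?_ ?_ (integrable_const _) ?_
  · exact (show Continuous fun y : ℝ => f (x + y • v) by fun_prop).aestronglyMeasurable
  · obtain ⟨C, hC⟩ := hf.exists_abs_le
    exact integrable_of_continuous_of_bounded (by fun_prop) ⟨C, fun y => hC _⟩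
  · exact (show Continuous fun y : ℝ => fderiv ℝ f (x + y • v) by fun_prop).aestronglyMeasurable
  · exact Eventually.of_forall fun y x _ => hK _
  · refine Eventually.of_forall fun y x _ => ?_
    simpa [Function.comp_def] using
      (hf.hasFDerivAt (x + y • v)).comp x ((hasFDerivAt_id x).add_const (y • v))

lemma IsC1bPos.fderiv_gaussAvg_apply {f : X → ℝ} (hf : IsC1bPos f) (v x u : X) :
    fderiv ℝ (gaussAvg v f) x u =
      ∫ y, fderiv ℝ f (x + y • v) u ∂(ProbabilityTheory.gaussianReal 0 1) := by
  rw [(hf.hasFDerivAt_gaussAvg v x).fderiv, ContinuousLinearMap.integral_apply]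
  obtain ⟨K, hK⟩ := hf.bounded_deriv
  have hc' := hf.continuous_fderiv
  exact Integrable.of_bound
    (show Continuous fun y : ℝ => fderiv ℝ f (x + y • v) by fun_prop).aestronglyMeasurable K
    (Eventually.of_forall fun y => hK _)

lemma IsC1bPos.gaussAvg {f : X → ℝ} (hf : IsC1bPos f) (v : X) : IsC1bPos (gaussAvg v f) := by
  have hc := hf.continuous
  have hc' := hf.continuous_fderiv
  obtain ⟨K, hK⟩ := hf.bounded_deriv
  obtain ⟨C, hC⟩ := hf.exists_abs_le
  have hfd : fderiv ℝ (OUEvol.gaussAvg v f) = fun x =>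
      ∫ y, fderiv ℝ f (x + y • v) ∂(ProbabilityTheory.gaussianReal 0 1) :=
    funext fun x => (hf.hasFDerivAt_gaussAvg v x).fderiv
  have hint : ∀ x, Integrable (fun y : ℝ => f (x + y • v)) (ProbabilityTheory.gaussianReal 0 1) :=
    fun x => integrable_of_continuous_of_bounded (by fun_prop) ⟨C, fun y => hC _⟩
  refine ⟨?_, ?_, ?_, ?_⟩
  · rw [contDiff_one_iff_fderiv]
    refine ⟨fun x => (hf.hasFDerivAt_gaussAvg v x).differentiableAt, ?_⟩
    rw [hfd]
    refine continuous_of_dominated (bound := fun _ => K) (fun x => ?_) (fun x => ?_)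
      (integrable_const _) ?_
    · exact (show Continuous fun y : ℝ => fderiv ℝ f (x + y • v) by fun_prop).aestronglyMeasurable
    · exact Eventually.of_forall fun y => hK _
    · exact Eventually.of_forall fun y => by fun_prop
  · obtain ⟨c, h0, hcf⟩ := hf.lower
    refine ⟨c, h0, fun x => ?_⟩
    have := integral_mono (integrable_const c) (hint x) (fun y => hcf _)
    simpa [OUEvol.gaussAvg] using this
  · obtain ⟨C', hC'⟩ := hf.upper
    refine ⟨C', fun x => ?_⟩
    have := integral_mono (hint x) (integrable_const C') (fun y => hC' _)
    simpa [OUEvol.gaussAvg] using this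
  · refine ⟨K, fun x => ?_⟩
    rw [hfd]
    have := norm_integral_le_of_norm_le_const (μ := ProbabilityTheory.gaussianReal 0 1)
      (f := fun y : ℝ => fderiv ℝ f (x + y • v)) (Eventually.of_forall fun y => hK _)
    simpa using this

/-- Cauchy-Schwarz in the form `(∫ a)² / ∫ b ≤ ∫ a² / b`. -/
lemma sq_integral_div_le {Y : Type*} [MeasurableSpace Y] {μ : Measure Y}
    {a b : Y → ℝ} (ha : Integrable a μ) (hb : Integrable b μ)
    (hab : Integrable (fun x => a x ^ 2 / b x) μ) (hpos : ∀ x, 0 < b x) (hb0 : 0 < ∫ x, b x ∂μ) :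
    (∫ x, a x ∂μ) ^ 2 / (∫ x, b x ∂μ) ≤ ∫ x, a x ^ 2 / b x ∂μ := by
  set A := ∫ x, a x ∂μ
  set B := ∫ x, b x ∂μ
  have h : ∫ x, (2 * (A / B) * a x - (A / B) ^ 2 * b x) ∂μ ≤ ∫ x, a x ^ 2 / b x ∂μ := by
    refine integral_mono ((ha.const_mul _).sub (hb.const_mul _)) hab fun x => ?_
    have hx := hpos x
    have h1 : a x ^ 2 / b x - (2 * (A / B) * a x - (A / B) ^ 2 * b x) =
        (a x - (A / B) * b x) ^ 2 / b x := by
      generalize A / B = l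
      field_simp; ring
    have h2 : 0 ≤ (a x - (A / B) * b x) ^ 2 / b x := by positivity
    simp only; linarith
  rw [integral_sub (ha.const_mul _) (hb.const_mul _), integral_const_mul, integral_const_mul] at h
  refine le_trans (le_of_eq ?_) h
  change A ^ 2 / B = 2 * (A / B) * A - (A / B) ^ 2 * B
  field_simp; ring

/-- Averaging contracts the Fisher information in each direction. -/
lemma IsC1bPos.sq_fderiv_gaussAvg_div_le {f : X → ℝ} (hf : IsC1bPos f) (v u x : X) :
    (fderiv ℝ (OUEvol.gaussAvg v f) x u) ^ 2 / OUEvol.gaussAvg v f x ≤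
      OUEvol.gaussAvg v (fun z => (fderiv ℝ f z u) ^ 2 / f z) x := by
  have hc := hf.continuous
  have hc' := hf.continuous_fderiv
  rw [hf.fderiv_gaussAvg_apply]
  refine sq_integral_div_le ?_ ?_ ?_ (fun y => hf.pos _) ((hf.gaussAvg v).pos x)
  · obtain ⟨K, hK⟩ := hf.exists_abs_fderiv_apply_le u
    exact integrable_of_continuous_of_bounded
      ((show Continuous fun y : ℝ => fderiv ℝ f (x + y • v) by fun_prop).clm_apply
        continuous_const) ⟨K, fun y => hK _⟩
  · obtain ⟨K, hK⟩ := hf.exists_abs_le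
    exact integrable_of_continuous_of_bounded (by fun_prop) ⟨K, fun y => hK _⟩
  · obtain ⟨K, hK⟩ := hf.exists_abs_sq_div_le u
    exact integrable_of_continuous_of_bounded
      ((hf.continuous_sq_div u).comp (by fun_prop)) ⟨K, fun y => hK _⟩

/-- The one-dimensional logarithmic Sobolev inequality along the line `x + ℝ v`. -/
lemma IsC1bPos.gaussAvg_mul_log_le {f : X → ℝ} (hf : IsC1bPos f) (v x : X) :
    OUEvol.gaussAvg v (fun z => f z * Real.log (f z)) x ≤
      OUEvol.gaussAvg v f x * Real.log (OUEvol.gaussAvg v f x) +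
      (1 / 2) * OUEvol.gaussAvg v (fun z => (fderiv ℝ f z v) ^ 2 / f z) x := by
  obtain ⟨c, hc, h⟩ := hf.lower
  obtain ⟨C, h'⟩ := hf.upper
  obtain ⟨K, hK⟩ := hf.exists_abs_fderiv_apply_le v
  have hfd := hf.continuous_fderiv
  have := logSobolev_gaussianReal (f := fun y => f (x + y • v))
    (f' := fun y => fderiv ℝ f (x + y • v) v) (fun y => ?_)
    ((show Continuous fun y : ℝ => fderiv ℝ f (x + y • v) by fun_prop).clm_apply
        continuous_const) hc (fun y => h _) (fun y => h' _) (fun y => hK _)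
  · unfold OUEvol.gaussAvg
    linarith
  · have h1 : HasDerivAt (fun y : ℝ => x + y • v) v y := by
      simpa using ((hasDerivAt_id y).smul_const v).const_add x
    exact (hf.hasFDerivAt _).comp_hasDerivAt y h1

variable [MeasurableSpace X] [BorelSpace X]

/-- The logarithmic Sobolev inequality for `μ`, with the energy of the directions `v i`, `i ∈ s`. -/
def HasLogSobolev {ι : Type*} (s : Finset ι) (v : ι → X) (μ : Measure X) : Prop :=
  ∀ f : X → ℝ, IsC1bPos f →
    (∫ x, f x * Real.log (f x) ∂μ) - (∫ x, f x ∂μ) * Real.log (∫ x, f x ∂μ) ≤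
      (1 / 2) * ∫ x, ∑ i ∈ s, (fderiv ℝ f x (v i)) ^ 2 / f x ∂μ

lemma hasLogSobolev_dirac {ι : Type*} (v : ι → X) (x : X) :
    HasLogSobolev ∅ v (Measure.dirac x) := by
  intro f hf
  rw [integral_dirac' _ _ hf.continuous_mul_log.stronglyMeasurable,
    integral_dirac' _ _ hf.continuous.stronglyMeasurable]
  simp

variable [SecondCountableTopology X]

lemma integral_map_add_smul_gaussian {μ : Measure X} [IsProbabilityMeasure μ] (v : X) {f : X → ℝ}
    (hf : Continuous f) (hb : ∃ K, ∀ x, |f x| ≤ K) :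
    ∫ x, f x ∂((μ.prod (ProbabilityTheory.gaussianReal 0 1)).map fun q => q.1 + q.2 • v) =
      ∫ x, gaussAvg v f x ∂μ := by
  have hc : Continuous fun q : X × ℝ => q.1 + q.2 • v := by fun_prop
  rw [integral_map hc.aemeasurable hf.aestronglyMeasurable, integral_prod]
  · rfl
  · obtain ⟨K, hK⟩ := hb
    exact integrable_of_continuous_of_bounded (hf.comp hc) ⟨K, fun q => hK _⟩

/-- The inductive step: adding an independent Gaussian in the direction `v a`. The entropy is the
mean entropy along the lines `x + ℝ v a`, plus the entropy of the averaged function. -/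
lemma HasLogSobolev.insert_direction {ι : Type*} [DecidableEq ι] {s : Finset ι} {v : ι → X}
    {μ : Measure X} [IsProbabilityMeasure μ] (h : HasLogSobolev s v μ) {a : ι} (ha : a ∉ s) :
    HasLogSobolev (insert a s) v
      ((μ.prod (ProbabilityTheory.gaussianReal 0 1)).map fun q => q.1 + q.2 • v a) := by
  intro f hf
  have hI : ∀ i, Integrable (fun x => OUEvol.gaussAvg (v a)
      (fun z => (fderiv ℝ f z (v i)) ^ 2 / f z) x) μ := fun i =>
    integrable_of_continuous_of_bounded
      (continuous_gaussAvg _ (hf.continuous_sq_div _) (hf.exists_abs_sq_div_le _))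
      (exists_abs_gaussAvg_le _ (hf.exists_abs_sq_div_le _))
  have hsum : ∫ x, ∑ i ∈ insert a s, (fderiv ℝ f x (v i)) ^ 2 / f x
        ∂((μ.prod (ProbabilityTheory.gaussianReal 0 1)).map fun q => q.1 + q.2 • v a) =
      ∑ i ∈ insert a s, ∫ x, gaussAvg (v a) (fun z => (fderiv ℝ f z (v i)) ^ 2 / f z) x ∂μ := by
    have hm : Measurable fun q : X × ℝ => q.1 + q.2 • v a := by fun_prop
    have := Measure.isProbabilityMeasure_map (μ := μ.prod (ProbabilityTheory.gaussianReal 0 1))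
      hm.aemeasurable
    rw [integral_finsetSum _ fun i _ => integrable_of_continuous_of_bounded
      (hf.continuous_sq_div _) (hf.exists_abs_sq_div_le _)]
    exact Finset.sum_congr rfl fun i _ =>
      integral_map_add_smul_gaussian _ (hf.continuous_sq_div _) (hf.exists_abs_sq_div_le _)
  rw [integral_map_add_smul_gaussian _ hf.continuous_mul_log hf.exists_abs_mul_log_le,
    integral_map_add_smul_gaussian _ hf.continuous hf.exists_abs_le, hsum, Finset.sum_insert ha]
  have hg := hf.gaussAvg (v a)
  have h1 := h _ hg
  have h2 : ∫ x, gaussAvg (v a) (fun z => f z * Real.log (f z)) x ∂μ ≤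
      (∫ x, gaussAvg (v a) f x * Real.log (gaussAvg (v a) f x) ∂μ) +
        (1 / 2) * ∫ x, gaussAvg (v a) (fun z => (fderiv ℝ f z (v a)) ^ 2 / f z) x ∂μ := by
    have hi : Integrable (fun x => gaussAvg (v a) f x * Real.log (gaussAvg (v a) f x)) μ :=
      integrable_of_continuous_of_bounded hg.continuous_mul_log hg.exists_abs_mul_log_le
    rw [← integral_const_mul, ← integral_add hi ((hI a).const_mul _)]
    refine integral_mono ?_ (hi.add ((hI a).const_mul _)) fun x => hf.gaussAvg_mul_log_le _ _
    exact integrable_of_continuous_of_bounded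
      (continuous_gaussAvg _ hf.continuous_mul_log hf.exists_abs_mul_log_le)
      (exists_abs_gaussAvg_le _ hf.exists_abs_mul_log_le)
  have h3 : ∫ x, ∑ i ∈ s, (fderiv ℝ (gaussAvg (v a) f) x (v i)) ^ 2 / gaussAvg (v a) f x ∂μ ≤
      ∑ i ∈ s, ∫ x, gaussAvg (v a) (fun z => (fderiv ℝ f z (v i)) ^ 2 / f z) x ∂μ := by
    rw [← integral_finsetSum _ fun i _ => hI i]
    refine integral_mono (integrable_finsetSum _ fun i _ => integrable_of_continuous_of_bounded
      (hg.continuous_sq_div _) (hg.exists_abs_sq_div_le _))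
      (integrable_finsetSum _ fun i _ => hI i) fun x => ?_
    exact Finset.sum_le_sum fun i _ => hf.sq_fderiv_gaussAvg_div_le _ _ _
  linarith

end GaussianSums

/-! ### Square roots of positive operators -/

section SquareRoot

variable {X : Type*} [NormedAddCommGroup X] [InnerProductSpace ℝ X]

/-- The iteration `Y₀ = 0`, `Yₙ₊₁ = (T + Yₙ²) / 2`, whose limit `Y` satisfies
`(1 - Y)² = 1 - T`. -/
noncomputable def sqrtIter (T : X →L[ℝ] X) : ℕ → X →L[ℝ] X
  | 0 => 0
  | n + 1 => (2⁻¹ : ℝ) • (T + sqrtIter T n * sqrtIter T n)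

/-- The scalar majorant of `sqrtIter`, for `T = 1`. -/
noncomputable def sqrtIterScalar : ℕ → ℝ
  | 0 => 0
  | n + 1 => 2⁻¹ * (1 + sqrtIterScalar n * sqrtIterScalar n)

lemma sqrtIterScalar_nonneg (n : ℕ) : 0 ≤ sqrtIterScalar n := by
  cases n with
  | zero => exact le_rfl
  | succ n => simp only [sqrtIterScalar]; nlinarith [mul_self_nonneg (sqrtIterScalar n)]

lemma sqrtIterScalar_le_one (n : ℕ) : sqrtIterScalar n ≤ 1 := by
  induction n with
  | zero => exact zero_le_one
  | succ n ih =>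
    simp only [sqrtIterScalar]
    nlinarith [sqrtIterScalar_nonneg n]

lemma sqrtIterScalar_mono : Monotone sqrtIterScalar :=
  monotone_nat_of_le_succ fun n => by
    simp only [sqrtIterScalar]
    nlinarith [mul_self_nonneg (sqrtIterScalar n - 1)]

lemma norm_sqrtIter_le {T : X →L[ℝ] X} (hT : ‖T‖ ≤ 1) (n : ℕ) :
    ‖sqrtIter T n‖ ≤ sqrtIterScalar n := by
  induction n with
  | zero => simp [sqrtIter, sqrtIterScalar]
  | succ n ih =>
    simp only [sqrtIter, sqrtIterScalar]
    rw [norm_smul, Real.norm_of_nonneg (by norm_num : (0 : ℝ) ≤ 2⁻¹)]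
    have h1 := norm_add_le T (sqrtIter T n * sqrtIter T n)
    have h2 := norm_mul_le (sqrtIter T n) (sqrtIter T n)
    have h3 := mul_le_mul ih ih (norm_nonneg _) (sqrtIterScalar_nonneg n)
    linarith

lemma norm_sqrtIter_succ_sub_le {T : X →L[ℝ] X} (hT : ‖T‖ ≤ 1) (n : ℕ) :
    ‖sqrtIter T (n + 1) - sqrtIter T n‖ ≤ sqrtIterScalar (n + 1) - sqrtIterScalar n := by
  induction n with
  | zero =>
    have := norm_sqrtIter_le hT 1
    simpa [sqrtIter, sqrtIterScalar] using this
  | succ n ih =>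
    have e : sqrtIter T (n + 1 + 1) - sqrtIter T (n + 1) = (2⁻¹ : ℝ) •
        (sqrtIter T (n + 1) * (sqrtIter T (n + 1) - sqrtIter T n) +
          (sqrtIter T (n + 1) - sqrtIter T n) * sqrtIter T n) := by
      conv_lhs => rw [sqrtIter, sqrtIter.eq_2 T n]
      rw [← smul_sub, ← sqrtIter.eq_2 T n]
      congr 1
      noncomm_ring
    have e' : sqrtIterScalar (n + 1 + 1) - sqrtIterScalar (n + 1) = 2⁻¹ *
        (sqrtIterScalar (n + 1) * (sqrtIterScalar (n + 1) - sqrtIterScalar n) +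
          (sqrtIterScalar (n + 1) - sqrtIterScalar n) * sqrtIterScalar n) := by
      conv_lhs => rw [sqrtIterScalar, sqrtIterScalar.eq_2 n]
      rw [← mul_sub, ← sqrtIterScalar.eq_2 n]
      ring
    rw [e, e', norm_smul, Real.norm_of_nonneg (by norm_num : (0 : ℝ) ≤ 2⁻¹)]
    refine mul_le_mul_of_nonneg_left ((norm_add_le _ _).trans (add_le_add ?_ ?_)) (by norm_num)
    · exact (norm_mul_le _ _).trans (mul_le_mul (norm_sqrtIter_le hT _) ih (norm_nonneg _)
        (sqrtIterScalar_nonneg _))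
    · exact (norm_mul_le _ _).trans (mul_le_mul ih (norm_sqrtIter_le hT _) (norm_nonneg _)
        (sub_nonneg.2 (sqrtIterScalar_mono n.le_succ)))

/-- Cauchy-Schwarz for the form `⟨Q x, y⟩` of a positive operator. -/
lemma norm_sq_apply_le {Q : X →L[ℝ] X} (hQ : Q.IsPositive) (x : X) :
    ‖Q x‖ ^ 2 ≤ ‖Q‖ * inner ℝ (Q x) x := by
  rcases (norm_nonneg Q).eq_or_lt with h0 | h0
  · have : Q = 0 := norm_eq_zero.1 h0.symm
    simp [this]
  -- positivity of the form at `x - ‖Q‖⁻¹ Q x`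
  have h := hQ.inner_nonneg_left (x - ‖Q‖⁻¹ • Q x)
  have hsym : inner ℝ (Q (Q x)) x = ‖Q x‖ ^ 2 := by
    rw [hQ.inner_left_eq_inner_right, real_inner_self_eq_norm_sq]
  have hb : inner ℝ (Q (Q x)) (Q x) ≤ ‖Q‖ * ‖Q x‖ ^ 2 := by
    calc inner ℝ (Q (Q x)) (Q x) ≤ ‖Q (Q x)‖ * ‖Q x‖ := real_inner_le_norm _ _
      _ ≤ ‖Q‖ * ‖Q x‖ * ‖Q x‖ :=
        mul_le_mul_of_nonneg_right (Q.le_opNorm _) (norm_nonneg _)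
      _ = _ := by ring
  simp only [map_sub, map_smul, inner_sub_left, inner_sub_right, real_inner_smul_left,
    real_inner_smul_right, real_inner_self_eq_norm_sq, hsym] at h
  have h2 : ‖Q‖⁻¹ * (‖Q‖⁻¹ * inner ℝ (Q (Q x)) (Q x)) ≤ ‖Q‖⁻¹ * ‖Q x‖ ^ 2 := by
    refine mul_le_mul_of_nonneg_left ?_ (inv_pos.2 h0).le
    rw [inv_mul_le_iff₀ h0]; exact hb
  have h3 : ‖Q‖⁻¹ * ‖Q x‖ ^ 2 ≤ inner ℝ (Q x) x := by linarith
  rwa [inv_mul_le_iff₀ h0] at h3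

variable [CompleteSpace X]

lemma exists_tendsto_sqrtIter {T : X →L[ℝ] X} (hT : ‖T‖ ≤ 1) :
    ∃ Y, Tendsto (sqrtIter T) atTop (𝓝 Y) := by
  apply cauchySeq_tendsto_of_complete
  refine cauchySeq_of_dist_le_of_summable
    (fun n => sqrtIterScalar (n + 1) - sqrtIterScalar n) (fun n => ?_) ?_
  · rw [dist_comm, dist_eq_norm]; exact norm_sqrtIter_succ_sub_le hT n
  · refine summable_of_sum_range_le (c := 1)
      (fun n => sub_nonneg.2 (sqrtIterScalar_mono n.le_succ)) fun n => ?_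
    rw [Finset.sum_range_sub]
    have := sqrtIterScalar_le_one n
    simpa [sqrtIterScalar] using this

lemma isSelfAdjoint_sqrtIter {T : X →L[ℝ] X} (hT : IsSelfAdjoint T) (n : ℕ) :
    IsSelfAdjoint (sqrtIter T n) := by
  induction n with
  | zero => exact IsSelfAdjoint.zero _
  | succ n ih =>
    refine IsSelfAdjoint.smul (IsSelfAdjoint.all _) (hT.add ?_)
    simpa [pow_two] using ih.pow 2

lemma exists_sqrt_of_norm_le_one {Q : X →L[ℝ] X} (hQ : Q.IsPositive) (h1 : ‖Q‖ ≤ 1) :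
    ∃ R : X →L[ℝ] X, R.IsPositive ∧ R * R = Q := by
  have hT : ‖(1 : X →L[ℝ] X) - Q‖ ≤ 1 := by
    refine ContinuousLinearMap.opNorm_le_bound _ zero_le_one fun x => ?_
    rw [one_mul]
    have h := norm_sq_apply_le hQ x
    have h0 := hQ.inner_nonneg_left x
    have h2 : ‖((1 : X →L[ℝ] X) - Q) x‖ ^ 2 ≤ ‖x‖ ^ 2 := by
      change ‖x - Q x‖ ^ 2 ≤ _
      rw [norm_sub_sq_real, real_inner_comm]
      nlinarith
    exact le_of_sq_le_sq h2 (norm_nonneg _)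
  obtain ⟨Y, hY⟩ := exists_tendsto_sqrtIter hT
  have hsa : IsSelfAdjoint Y := by
    have h2 : Tendsto (fun n => star (sqrtIter ((1 : X →L[ℝ] X) - Q) n)) atTop (𝓝 (star Y)) :=
      (continuous_star.tendsto _).comp hY
    refine tendsto_nhds_unique h2 (hY.congr fun n => ?_)
    exact (isSelfAdjoint_sqrtIter ((IsSelfAdjoint.one _).sub hQ.isSelfAdjoint) n).symm
  have hYn : ‖Y‖ ≤ 1 := le_of_tendsto hY.norm
    (Eventually.of_forall fun n => (norm_sqrtIter_le hT n).trans (sqrtIterScalar_le_one n))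
  have heq : Y = (2⁻¹ : ℝ) • ((1 - Q) + Y * Y) := by
    refine tendsto_nhds_unique (hY.comp (tendsto_add_atTop_nat 1)) ?_
    exact ((tendsto_const_nhds (x := (1 : X →L[ℝ] X) - Q)).add (hY.mul hY)).const_smul (2⁻¹ : ℝ)
  refine ⟨1 - Y, ?_, ?_⟩
  · rw [ContinuousLinearMap.isPositive_iff']
    refine ⟨(IsSelfAdjoint.one _).sub hsa, fun x => ?_⟩
    change 0 ≤ inner ℝ (x - Y x) x
    rw [inner_sub_left, real_inner_self_eq_norm_sq]
    have := real_inner_le_norm (Y x) x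
    have h3 : ‖Y x‖ ≤ ‖x‖ := (Y.le_opNorm x).trans
      (mul_le_of_le_one_left (norm_nonneg _) hYn)
    nlinarith [norm_nonneg x]
  · have h2 : Y + Y = (1 - Q) + Y * Y := by
      rw [← two_smul ℝ Y]
      conv_lhs => rw [heq]
      rw [smul_smul]; norm_num
    have h3 : (1 - Y) * (1 - Y) = 1 - (Y + Y) + Y * Y := by noncomm_ring
    rw [h3, h2]; abel

theorem exists_sqrt {Q : X →L[ℝ] X} (hQ : Q.IsPositive) :
    ∃ R : X →L[ℝ] X, R.IsPositive ∧ R ∘L R = Q := by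
  set c := ‖Q‖ + 1
  have hc : 0 < c := by positivity
  obtain ⟨R, hR, hRR⟩ := exists_sqrt_of_norm_le_one (Q := c⁻¹ • Q)
    (hQ.smul_of_nonneg (inv_pos.2 hc).le) (by
      rw [norm_smul, Real.norm_of_nonneg (inv_pos.2 hc).le, inv_mul_le_iff₀ hc, mul_one]
      exact (lt_add_one _).le)
  refine ⟨√c • R, hR.smul_of_nonneg (Real.sqrt_nonneg _), ?_⟩
  change (√c • R) * (√c • R) = Q
  rw [smul_mul_smul_comm, hRR, Real.mul_self_sqrt hc.le, smul_smul, mul_inv_cancel₀ hc.ne',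
    one_smul]

lemma posSqrt_spec {Q : X →L[ℝ] X} (hQ : Q.IsPositive) :
    (posSqrt Q).IsPositive ∧ posSqrt Q ∘L posSqrt Q = Q :=
  Classical.epsilon_spec (exists_sqrt hQ)

lemma norm_sq_posSqrt_apply {Q : X →L[ℝ] X} (hQ : Q.IsPositive) (x : X) :
    ‖posSqrt Q x‖ ^ 2 = inner ℝ (Q x) x := by
  obtain ⟨h1, h2⟩ := posSqrt_spec hQ
  conv_rhs => rw [← h2]
  rw [ContinuousLinearMap.comp_apply, h1.inner_left_eq_inner_right, real_inner_self_eq_norm_sq]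

end SquareRoot

/-! ### Gaussian measures as laws of Gaussian series -/

section GaussianSeries

open ProbabilityTheory

variable {X : Type*} [NormedAddCommGroup X] [InnerProductSpace ℝ X] {ι : Type*}

/-- The law of a family of independent standard real Gaussians. -/
noncomputable def whiteNoise (ι : Type*) : Measure (ι → ℝ) :=
  Measure.infinitePi fun _ => gaussianReal 0 1

instance : IsProbabilityMeasure (whiteNoise ι) := by unfold whiteNoise; infer_instance

/-- The finite Gaussian sum `∑ i ∈ s, gᵢ vᵢ`. -/
def gaussSum (v : ι → X) (s : Finset ι) (ω : ι → ℝ) : X := ∑ i ∈ s, ω i • v i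

lemma measurePreserving_eval_whiteNoise (i : ι) :
    MeasurePreserving (fun ω : ι → ℝ => ω i) (whiteNoise ι) (gaussianReal 0 1) :=
  measurePreserving_eval_infinitePi _ i

lemma iIndepFun_whiteNoise :
    iIndepFun (fun (i : ι) (ω : ι → ℝ) => ω i) (whiteNoise ι) :=
  iIndepFun_infinitePi (X := fun _ x => x) fun _ => measurable_id

lemma memLp_eval_whiteNoise (i : ι) : MemLp (fun ω : ι → ℝ => ω i) 2 (whiteNoise ι) :=
  (memLp_id_gaussianReal (μ := 0) (v := 1) 2).comp_measurePreserving
    (measurePreserving_eval_whiteNoise i)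

lemma integral_eval_whiteNoise (i : ι) : ∫ ω : ι → ℝ, ω i ∂(whiteNoise ι) = 0 := by
  have h := measurePreserving_eval_whiteNoise (ι := ι) i
  have : ∫ y, y ∂(gaussianReal 0 1) = 0 := integral_id_gaussianReal
  rwa [← h.map_eq, integral_map h.measurable.aemeasurable
    (by fun_prop)] at this

lemma integral_eval_mul_eval_whiteNoise [DecidableEq ι] (i j : ι) :
    ∫ ω : ι → ℝ, ω i * ω j ∂(whiteNoise ι) = if i = j then 1 else 0 := by
  split_ifs with h
  · subst h
    have h := measurePreserving_eval_whiteNoise (ι := ι) i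
    have h1 := variance_id_gaussianReal (μ := 0) (v := 1)
    rw [variance_of_integral_eq_zero measurable_id.aemeasurable
      (by simp), ← h.map_eq,
      integral_map h.measurable.aemeasurable
        (by fun_prop)] at h1
    simpa [pow_two] using h1
  · have := (iIndepFun_whiteNoise.indepFun h).integral_fun_mul_eq_mul_integral
      (measurePreserving_eval_whiteNoise i).measurable.aestronglyMeasurable
      (measurePreserving_eval_whiteNoise j).measurable.aestronglyMeasurable
    rw [this, integral_eval_whiteNoise, zero_mul]

variable [MeasurableSpace X] [BorelSpace X]

/-- A square-summable Gaussian series converges in `L²`, hence almost surely along a subsequence of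
its finite partial sums. -/
lemma exists_tendsto_gaussSum [CompleteSpace X] [Countable ι] {v : ι → X}
    (hv : Summable fun i => ‖v i‖ ^ 2) :
    ∃ (S : (ι → ℝ) → X) (ns : ℕ → Finset ι), AEMeasurable S (whiteNoise ι) ∧
      Tendsto ns atTop atTop ∧
      ∀ᵐ ω ∂(whiteNoise ι), Tendsto (fun k => gaussSum v (ns k) ω) atTop (𝓝 (S ω)) := by
  classical
  have hmem : ∀ i, MemLp (fun ω : ι → ℝ => ω i • v i) 2 (whiteNoise ι) := fun i =>
    (ContinuousLinearMap.toSpanSingleton ℝ (v i)).comp_memLp' (memLp_eval_whiteNoise i)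
  let a : ι → Lp X 2 (whiteNoise ι) := fun i => (hmem i).toLp
  have hinner : ∀ i j, inner ℝ (a i) (a j) = if i = j then ‖v i‖ ^ 2 else 0 := by
    intro i j
    have e : ∀ᵐ ω ∂(whiteNoise ι), inner ℝ (a i ω) (a j ω) =
        (ω i * ω j) * inner ℝ (v i) (v j) := by
      filter_upwards [(hmem i).coeFn_toLp, (hmem j).coeFn_toLp] with ω h1 h2
      rw [h1, h2, real_inner_smul_left, real_inner_smul_right]; ring
    rw [L2.inner_def, integral_congr_ae e, integral_mul_const, integral_eval_mul_eval_whiteNoise]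
    split_ifs with h
    · subst h; simp
    · simp
  have hsumm : Summable a := by
    rw [summable_iff_vanishing_norm]
    intro ε hε
    obtain ⟨s, hs⟩ := summable_iff_vanishing_norm.1 hv (ε ^ 2) (by positivity)
    refine ⟨s, fun t ht => ?_⟩
    have h1 : ‖∑ i ∈ t, a i‖ ^ 2 = ∑ i ∈ t, ‖v i‖ ^ 2 := by
      rw [← real_inner_self_eq_norm_sq, sum_inner]
      refine Finset.sum_congr rfl fun i hi => ?_
      rw [inner_sum]
      simp [hinner, hi]
    have h2 := hs t ht
    rw [← h1, Real.norm_of_nonneg (sq_nonneg _)] at h2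
    exact lt_of_pow_lt_pow_left₀ 2 hε.le h2
  obtain ⟨S, hS⟩ := hsumm
  have hm := tendstoInMeasure_of_tendsto_Lp hS
  have hm' : TendstoInMeasure (whiteNoise ι) (fun s => gaussSum v s) atTop S := by
    refine hm.congr_left fun s => ?_
    refine (Lp.coeFn_finsetSum s a).trans ?_
    have h2 : ∀ᵐ ω ∂(whiteNoise ι), ∀ i ∈ s, a i ω = ω i • v i := by
      rw [Filter.eventually_all_finset]
      exact fun i _ => (hmem i).coeFn_toLp
    filter_upwards [h2] with ω h2
    simp only [Finset.sum_apply, gaussSum]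
    exact Finset.sum_congr rfl h2
  obtain ⟨ns, h1, h2⟩ := hm'.exists_seq_tendsto_ae'
  exact ⟨S, ns, (Lp.aestronglyMeasurable S).aemeasurable, h1, h2⟩

variable [SecondCountableTopology X]

lemma measurable_gaussSum (v : ι → X) (s : Finset ι) : Measurable (gaussSum v s) := by
  unfold gaussSum
  exact Finset.measurable_sum _ fun i _ => (measurable_pi_apply i).smul_const _

lemma map_gaussSum_insert [DecidableEq ι] (v : ι → X) {s : Finset ι} {a : ι} (ha : a ∉ s) :
    (whiteNoise ι).map (gaussSum v (insert a s)) =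
      (((whiteNoise ι).map (gaussSum v s)).prod (gaussianReal 0 1)).map
        fun q => q.1 + q.2 • v a := by
  have h1 := (iIndepFun_whiteNoise (ι := ι)).indepFun_finset s {a}
    (Finset.disjoint_singleton_right.2 ha) fun i => measurable_pi_apply i
  have h2 : IndepFun (gaussSum v s) (fun ω : ι → ℝ => ω a) (whiteNoise ι) := by
    have hφ : Measurable fun y : s → ℝ => ∑ i : s, y i • v i :=
      Finset.measurable_sum _ fun i _ => (measurable_pi_apply i).smul_const _
    have hψ : Measurable fun y : ({a} : Finset ι) → ℝ => y ⟨a, Finset.mem_singleton_self a⟩ :=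
      measurable_pi_apply _
    have := h1.comp hφ hψ
    convert! this using 1
    ext ω
    simp only [gaussSum, Function.comp_apply]
    exact (Finset.sum_coe_sort s fun i => ω i • v i).symm
  have hm := measurable_gaussSum v s
  rw [indepFun_iff_map_prod_eq_prod_map_map hm.aemeasurable
    (measurable_pi_apply a).aemeasurable,
    (measurePreserving_eval_whiteNoise a).map_eq] at h2
  rw [← h2, Measure.map_map (by fun_prop) (hm.prodMk (measurable_pi_apply a))]
  congr 1
  ext ω
  simp [gaussSum, Finset.sum_insert ha, add_comm]

lemma hasLogSobolev_map_gaussSum (v : ι → X) (s : Finset ι) :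
    HasLogSobolev s v ((whiteNoise ι).map (gaussSum v s)) := by
  classical
  induction s using Finset.induction_on with
  | empty =>
    have : gaussSum v ∅ = fun _ => 0 := by ext; simp [gaussSum]
    rw [this, Measure.map_const, measure_univ, one_smul]
    exact hasLogSobolev_dirac v 0
  | insert a s ha ih =>
    have := Measure.isProbabilityMeasure_map (μ := whiteNoise ι)
      (measurable_gaussSum v s).aemeasurable
    rw [map_gaussSum_insert v ha]
    exact ih.insert_direction ha

lemma charFun_map_gaussSum (v : ι → X) (s : Finset ι) (h : X) :
    charFun ((whiteNoise ι).map (gaussSum v s)) h =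
      Complex.exp (-((∑ i ∈ s, (inner ℝ (v i) h) ^ 2 : ℝ) : ℂ) / 2) := by
  classical
  induction s using Finset.induction_on with
  | empty =>
    have : gaussSum v ∅ = fun _ => 0 := by ext; simp [gaussSum]
    rw [this, Measure.map_const, measure_univ, one_smul]
    simp
  | insert a s ha ih =>
    have := Measure.isProbabilityMeasure_map (μ := whiteNoise ι)
      (measurable_gaussSum v s).aemeasurable
    have hG := charFun_gaussianReal (μ := 0) (v := 1) (inner ℝ (v a) h)
    rw [charFun_apply] at ih hG
    rw [map_gaussSum_insert v ha, charFun_apply, integral_map (by fun_prop)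
      (by fun_prop)]
    have e : ∀ q : X × ℝ, Complex.exp ((inner ℝ (q.1 + q.2 • v a) h : ℝ) * Complex.I) =
        Complex.exp ((inner ℝ q.1 h : ℝ) * Complex.I) *
          Complex.exp ((inner ℝ q.2 (inner ℝ (v a) h) : ℝ) * Complex.I) := fun q => by
      rw [← Complex.exp_add, inner_add_left, real_inner_smul_left]
      congr 1
      simp only [RCLike.inner_apply, conj_trivial]
      push_cast; ring
    simp only [e]
    rw [integral_prod_mul (fun x => Complex.exp ((inner ℝ x h : ℝ) * Complex.I))
      (fun y : ℝ => Complex.exp ((inner ℝ y (inner ℝ (v a) h) : ℝ) * Complex.I)), ih, hG,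
      ← Complex.exp_add, Finset.sum_insert ha]
    congr 1
    push_cast; ring

/-- The Gaussian measure with covariance form `∑ᵢ ⟨vᵢ, h⟩²`, for square-summable `vᵢ`, and its
logarithmic Sobolev inequality. The energy enters through any bounded continuous majorant `E` of
the partial sums, so that it passes to the limit. -/
theorem exists_gaussian_logSobolev [CompleteSpace X] [Countable ι] {v : ι → X}
    (hv : Summable fun i => ‖v i‖ ^ 2) :
    ∃ γ : Measure X, IsProbabilityMeasure γ ∧
      (∀ (h : X) (q : ℝ), HasSum (fun i => (inner ℝ (v i) h) ^ 2) q →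
        charFun γ h = Complex.exp (-(q : ℂ) / 2)) ∧
      ∀ f : X → ℝ, IsC1bPos f → ∀ E : X → ℝ, Continuous E → (∃ K, ∀ x, |E x| ≤ K) →
        (∀ (s : Finset ι) (x : X), ∑ i ∈ s, (fderiv ℝ f x (v i)) ^ 2 / f x ≤ E x) →
        (∫ x, f x * Real.log (f x) ∂γ) - (∫ x, f x ∂γ) * Real.log (∫ x, f x ∂γ) ≤
          (1 / 2) * ∫ x, E x ∂γ := by
  obtain ⟨S, ns, hSm, hns, hS⟩ := exists_tendsto_gaussSum hv
  have hprob : IsProbabilityMeasure ((whiteNoise ι).map S) :=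
    Measure.isProbabilityMeasure_map hSm
  have hlim : ∀ {F : Type _} [NormedAddCommGroup F] [NormedSpace ℝ F] [SecondCountableTopology F]
      (g : X → F), Continuous g → (∃ K, ∀ x, ‖g x‖ ≤ K) →
      Tendsto (fun k => ∫ x, g x ∂((whiteNoise ι).map (gaussSum v (ns k)))) atTop
        (𝓝 (∫ x, g x ∂((whiteNoise ι).map S))) := by
    intro F _ _ _ g hg ⟨K, hK⟩
    rw [integral_map hSm hg.aestronglyMeasurable]
    simp_rw [fun k => integral_map (measurable_gaussSum v (ns k)).aemeasurable (μ := whiteNoise ι)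
      (hg.aestronglyMeasurable (μ := (whiteNoise ι).map (gaussSum v (ns k))))]
    refine tendsto_integral_of_dominated_convergence (fun _ => K) (fun k => ?_)
      (integrable_const _) (fun k => Eventually.of_forall fun ω => hK _) ?_
    · exact hg.comp_aestronglyMeasurable (measurable_gaussSum v (ns k)).aestronglyMeasurable
    · filter_upwards [hS] with ω h
      exact (hg.tendsto _).comp h
  refine ⟨(whiteNoise ι).map S, hprob, ?_, ?_⟩
  · intro h q hq
    have h1 := hlim (fun x => Complex.exp ((inner ℝ x h : ℝ) * Complex.I)) (by fun_prop)
      ⟨1, fun x => (Complex.norm_exp_ofReal_mul_I _).le⟩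
    simp only [← charFun_apply, charFun_map_gaussSum] at h1
    refine tendsto_nhds_unique h1 ?_
    refine (Complex.continuous_exp.tendsto _).comp (Tendsto.div_const (Tendsto.neg ?_) 2)
    exact (Complex.continuous_ofReal.tendsto _).comp (hq.comp hns)
  · intro f hf E hE hEb hle
    have hpos : 0 < ∫ x, f x ∂((whiteNoise ι).map S) := by
      obtain ⟨c, hc, hcf⟩ := hf.lower
      have := integral_mono (μ := (whiteNoise ι).map S) (integrable_const c)
        (integrable_of_continuous_of_bounded hf.continuous hf.exists_abs_le) (fun y => hcf _)
      simp only [integral_const, probReal_univ, one_smul] at this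
      exact hc.trans_le this
    have l1 := hlim _ hf.continuous_mul_log hf.exists_abs_mul_log_le
    have l2 := hlim _ hf.continuous hf.exists_abs_le
    have l3 := hlim _ hE hEb
    refine le_of_tendsto_of_tendsto' (l1.sub (l2.mul (l2.log hpos.ne'))) (l3.const_mul _)
      fun k => ?_
    have := Measure.isProbabilityMeasure_map (μ := whiteNoise ι)
      (measurable_gaussSum v (ns k)).aemeasurable
    refine (hasLogSobolev_map_gaussSum v (ns k) f hf).trans
      (mul_le_mul_of_nonneg_left ?_ (by norm_num))
    refine integral_mono (integrable_finsetSum _ fun i _ => integrable_of_continuous_of_bounded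
      (hf.continuous_sq_div _) (hf.exists_abs_sq_div_le _))
      (integrable_of_continuous_of_bounded hE hEb) fun x => hle _ x

end GaussianSeries

/-! ### Measurability of weakly measurable maps -/

section WeakMeasurability

variable {X : Type*} [NormedAddCommGroup X] [InnerProductSpace ℝ X]

lemma HilbertBasis.countable [TopologicalSpace.SeparableSpace X] {ι : Type*}
    (b : HilbertBasis ι ℝ X) : Countable ι := by
  -- the balls of radius `1/2` around the basis vectors are disjoint
  refine Pairwise.countable_of_isOpen_disjoint (s := fun i => Metric.ball (b i) (1 / 2)) ?_
    (fun i => Metric.isOpen_ball) fun i => ⟨b i, Metric.mem_ball_self (by norm_num)⟩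
  intro i j hij
  refine Metric.ball_disjoint_ball ?_
  have h : ‖b i - b j‖ ^ 2 = 2 := by
    rw [norm_sub_sq_real, b.orthonormal.1, b.orthonormal.1, b.orthonormal.2 hij]
    norm_num
  rw [dist_eq_norm]
  nlinarith [norm_nonneg (b i - b j)]

/-- Pettis' theorem for a separable Hilbert space. -/
lemma aestronglyMeasurable_of_inner [CompleteSpace X] [TopologicalSpace.SeparableSpace X]
    {Y : Type*} [MeasurableSpace Y] {μ : Measure Y} {f : Y → X}
    (h : ∀ y, AEStronglyMeasurable (fun a => inner ℝ (f a) y) μ) : AEStronglyMeasurable f μ := by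
  have hc : Countable (basisIndex X) := HilbertBasis.countable (basis X)
  refine aestronglyMeasurable_of_tendsto_ae (atTop : Filter (Finset (basisIndex X)))
    (f := fun s a => ∑ i ∈ s, (inner ℝ (f a) (basis X i) : ℝ) • basis X i) (fun s => ?_)
    (Eventually.of_forall fun a => ?_)
  · exact Finset.aestronglyMeasurable_fun_sum _ fun i _ => (h _).smul_const _
  · have := (basis X).hasSum_repr (f a)
    simp only [HilbertBasis.repr_apply_apply, real_inner_comm (f a)] at this
    exact this

end WeakMeasurability

/-! ### The Cameron-Martin norm and the domination of the covariance -/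

section PseudoInverse

variable {X : Type*} [NormedAddCommGroup X] [InnerProductSpace ℝ X] [CompleteSpace X]

lemma pseudoInv_spec (R : X →L[ℝ] X) {y : X} (hy : y ∈ range R) :
    (∀ z : X, R z = 0 → inner ℝ z (pseudoInv R y) = 0) ∧ R (pseudoInv R y) = y := by
  obtain ⟨x, rfl⟩ := hy
  have h : ∃ u : X, (∀ z : X, R z = 0 → inner ℝ z u = 0) ∧ R u = R x := by
    have hclosed : IsClosed (R.ker : Set X) := R.isClosed_ker
    have : CompleteSpace R.ker := hclosed.completeSpace_coe
    obtain ⟨a, ha, b, hb, hab⟩ := R.ker.exists_add_mem_mem_orthogonal x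
    refine ⟨b, fun z hz => hb z hz, ?_⟩
    rw [hab, map_add, show R a = 0 from ha, zero_add]
  rw [pseudoInv, dif_pos h]
  exact h.choose_spec

lemma rangeNorm_apply_le (R : X →L[ℝ] X) (z : X) : rangeNorm R (R z) ≤ ‖z‖ := by
  obtain ⟨h1, h2⟩ := pseudoInv_spec R (mem_range_self z)
  have h3 := h1 (z - pseudoInv R (R z)) (by rw [map_sub, h2, sub_self])
  rw [inner_sub_left, real_inner_self_eq_norm_sq, sub_eq_zero] at h3
  have h4 := real_inner_le_norm z (pseudoInv R (R z))
  rw [rangeNorm]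
  by_contra! h5
  nlinarith [norm_nonneg z]

end PseudoInverse

section Covariance

variable {X : Type*} [NormedAddCommGroup X] [InnerProductSpace ℝ X] [CompleteSpace X]
  {U : ℝ → ℝ → X →L[ℝ] X} {B : ℝ → X →L[ℝ] X}

/-- `B(r)⋆ U(t,r)⋆`, so that `⟨U(t,r) Q(r) U(t,r)⋆ x, y⟩` is the inner product of its values at
`x` and `y`. -/
noncomputable def backwardNoise (U : ℝ → ℝ → X →L[ℝ] X) (B : ℝ → X →L[ℝ] X) (t r : ℝ) :
    X →L[ℝ] X :=
  ContinuousLinearMap.adjoint (B r) ∘L ContinuousLinearMap.adjoint (U t r)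

lemma isPositive_diffusion (B : ℝ → X →L[ℝ] X) (r : ℝ) : (diffusion B r).IsPositive :=
  ContinuousLinearMap.isPositive_self_comp_adjoint _

lemma integrand_eq (U : ℝ → ℝ → X →L[ℝ] X) (B : ℝ → X →L[ℝ] X) (t r : ℝ) (x : X) :
    U t r (diffusion B r (ContinuousLinearMap.adjoint (U t r) x)) =
      ContinuousLinearMap.adjoint (backwardNoise U B t r) (backwardNoise U B t r x) := by
  simp [diffusion, backwardNoise, ContinuousLinearMap.adjoint_comp]

lemma inner_integrand (U : ℝ → ℝ → X →L[ℝ] X) (B : ℝ → X →L[ℝ] X) (t r : ℝ) (x y : X) :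
    inner ℝ (U t r (diffusion B r (ContinuousLinearMap.adjoint (U t r) x))) y =
      inner ℝ (backwardNoise U B t r x) (backwardNoise U B t r y) := by
  rw [integrand_eq, ContinuousLinearMap.adjoint_inner_left]

lemma inner_backwardNoise (t r : ℝ) (x y : X) : inner ℝ (backwardNoise U B t r x) y =
    inner ℝ (ContinuousLinearMap.adjoint (U t r) x) (B r y) :=
  ContinuousLinearMap.adjoint_inner_left (B r) y (ContinuousLinearMap.adjoint (U t r) x)

/-- The bound on `U(t,s) : H_s → H_t`, dualised: `‖Q(s)^{1/2} U(t,s)⋆ x‖ ≤ K ‖Q(t)^{1/2} x‖`. -/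
lemma norm_backwardNoise_le {s t K : ℝ} (hK : 0 ≤ K) (h : MapsRangeWithNormLE U B s t K) (x : X) :
    ‖backwardNoise U B t s x‖ ≤ K * ‖sqrtDiffusion B t x‖ := by
  obtain ⟨hs, -⟩ := posSqrt_spec (isPositive_diffusion B s)
  obtain ⟨ht, -⟩ := posSqrt_spec (isPositive_diffusion B t)
  set z := sqrtDiffusion B s (ContinuousLinearMap.adjoint (U t s) x) with hz
  have h1 : ‖backwardNoise U B t s x‖ ^ 2 = ‖z‖ ^ 2 := by
    rw [hz, sqrtDiffusion, norm_sq_posSqrt_apply (isPositive_diffusion B s),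
      ContinuousLinearMap.adjoint_inner_right, inner_integrand, real_inner_self_eq_norm_sq]
  have h2 : ‖backwardNoise U B t s x‖ = ‖z‖ := by
    rwa [sq_eq_sq₀ (norm_nonneg _) (norm_nonneg _)] at h1
  obtain ⟨h3, h4⟩ := h (sqrtDiffusion B s z) (mem_range_self z)
  have h5 := (pseudoInv_spec _ h3).2
  rw [rangeNorm] at h4
  set w := pseudoInv (sqrtDiffusion B t) (U t s (sqrtDiffusion B s z))
  have hw : ‖w‖ ≤ K * ‖z‖ := h4.trans (mul_le_mul_of_nonneg_left (rangeNorm_apply_le _ _) hK)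
  have h6 : ‖z‖ ^ 2 = inner ℝ (sqrtDiffusion B t x) w := by
    rw [← real_inner_self_eq_norm_sq]
    conv_lhs => enter [2]; rw [hz]
    rw [sqrtDiffusion, hs.inner_left_eq_inner_right, ContinuousLinearMap.adjoint_inner_left]
    rw [sqrtDiffusion, ht.inner_left_eq_inner_right]
    change _ = inner ℝ x (sqrtDiffusion B t w)
    rw [h5]; rfl
  have h7 := real_inner_le_norm (sqrtDiffusion B t x) w
  rw [h2]
  by_contra! h8
  have hzpos : 0 < ‖z‖ := lt_of_le_of_lt (by positivity) h8
  nlinarith [mul_le_mul_of_nonneg_left hw (norm_nonneg (sqrtDiffusion B t x))]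

variable [TopologicalSpace.SeparableSpace X]

lemma aestronglyMeasurable_adjoint_evolution (hU : IsEvolutionOperator U) (t : ℝ) (x : X) :
    AEStronglyMeasurable (fun r => ContinuousLinearMap.adjoint (U t r) x)
      (volume.restrict (Iic t)) := by
  refine aestronglyMeasurable_of_inner fun y => ?_
  have hc : ContinuousOn (fun r => U t r y) (Iic t) :=
    (hU.strongly_continuous y).comp (f := fun r => (r, t)) (by fun_prop) fun r hr => hr
  have hm : AEStronglyMeasurable (fun r => U t r y) (volume.restrict (Iic t)) :=
    hc.aestronglyMeasurable measurableSet_Iic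
  refine ((aestronglyMeasurable_const (b := x)).inner (𝕜 := ℝ) hm).congr
    (Eventually.of_forall fun r => ?_)
  exact (ContinuousLinearMap.adjoint_inner_left (U t r) y x).symm

lemma aestronglyMeasurable_backwardNoise (hU : IsEvolutionOperator U)
    (hB : IsBoundedStronglyContinuous B) (t : ℝ) (x : X) :
    AEStronglyMeasurable (fun r => backwardNoise U B t r x) (volume.restrict (Iic t)) := by
  refine aestronglyMeasurable_of_inner fun y => ?_
  have h2 : AEStronglyMeasurable (fun r => B r y) (volume.restrict (Iic t)) :=
    (hB.strongly_continuous y).aestronglyMeasurable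
  simp only [inner_backwardNoise]
  exact (aestronglyMeasurable_adjoint_evolution hU t x).inner h2

lemma aestronglyMeasurable_integrand (hU : IsEvolutionOperator U)
    (hB : IsBoundedStronglyContinuous B) (t : ℝ) (x : X) :
    AEStronglyMeasurable
      (fun r => U t r (diffusion B r (ContinuousLinearMap.adjoint (U t r) x)))
      (volume.restrict (Iic t)) := by
  refine aestronglyMeasurable_of_inner fun y => ?_
  simp only [inner_integrand]
  exact (aestronglyMeasurable_backwardNoise hU hB t x).inner
    (aestronglyMeasurable_backwardNoise hU hB t y)

end Covariance

/-- The time integral of the squared bound on `‖U(t,r)‖_{L(H_r;H_t)}`, by the Gamma integral. -/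
lemma integral_kernel_sq (C : ℝ) {η α : ℝ} (hη : 0 < η) (hα : α < 1 / 2) (t : ℝ) :
    IntegrableOn (fun r => (C * (Real.exp (-η * (t - r)) / (t - r) ^ α)) ^ 2) (Iic t) ∧
      ∫ r in Iic t, (C * (Real.exp (-η * (t - r)) / (t - r) ^ α)) ^ 2 =
        C ^ 2 * ((2 * η) ^ (2 * α - 1) * Real.Gamma (1 - 2 * α)) := by
  set G : ℝ → ℝ := (Ioi 0).indicator fun u => u ^ (1 - 2 * α - 1) * Real.exp (-(2 * η * u))
  have hG : Integrable G := by
    rw [integrable_indicator_iff measurableSet_Ioi]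
    refine (integrableOn_rpow_mul_exp_neg_mul_rpow (p := 1) (s := 1 - 2 * α - 1) (b := 2 * η)
      (by linarith) one_pos (by linarith)).congr_fun (fun u _ => ?_) measurableSet_Ioi
    simp only [Real.rpow_one, neg_mul]
  have hGi : ∫ u, G u = (2 * η) ^ (2 * α - 1) * Real.Gamma (1 - 2 * α) := by
    rw [integral_indicator measurableSet_Ioi,
      Real.integral_rpow_mul_exp_neg_mul_Ioi (by linarith) (by linarith), one_div,
      Real.inv_rpow (by linarith), ← Real.rpow_neg (by linarith), neg_sub]
  have e : EqOn (fun r => C ^ 2 * G (t - r))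
      (fun r => (C * (Real.exp (-η * (t - r)) / (t - r) ^ α)) ^ 2) (Iio t) := by
    intro r hr
    have hu : 0 < t - r := sub_pos.2 hr
    simp only [G]
    rw [indicator_of_mem (mem_Ioi.2 hu), mul_pow, div_pow, ← Real.exp_nat_mul, 
      ← Real.rpow_natCast ((t - r) ^ α) 2,
      ← Real.rpow_mul hu.le, show 1 - 2 * α - 1 = -(α * (2 : ℕ)) by push_cast; ring,
      Real.rpow_neg hu.le, div_eq_inv_mul]
    congr 3
    push_cast; ring
  have e0 : ∀ r, r ∉ Iio t → C ^ 2 * G (t - r) = 0 := by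
    intro r hr
    have : t - r ∉ Ioi (0 : ℝ) := fun h => hr (by have := mem_Ioi.1 h; exact mem_Iio.2 (by linarith))
    simp only [G]
    rw [indicator_of_notMem this, mul_zero]
  have hint : Integrable fun r => C ^ 2 * G (t - r) := (hG.comp_sub_left t).const_mul _
  constructor
  · rw [integrableOn_Iic_iff_integrableOn_Iio]
    exact hint.integrableOn.congr_fun e measurableSet_Iio
  · rw [integral_Iic_eq_integral_Iio, ← setIntegral_congr_fun measurableSet_Iio e,
      setIntegral_eq_integral_of_forall_compl_eq_zero e0, integral_const_mul,
      integral_sub_left_eq_self G volume t, hGi]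

section CovarianceOperator

variable {X : Type*} [NormedAddCommGroup X] [InnerProductSpace ℝ X] [CompleteSpace X]
  [TopologicalSpace.SeparableSpace X]
  {U : ℝ → ℝ → X →L[ℝ] X} {B : ℝ → X →L[ℝ] X} {A : ℝ → X →ₗ.[ℝ] X} {C η α : ℝ}

lemma integrableOn_integrand (hU : IsEvolutionOperator U)
    (hB : IsBoundedStronglyContinuous B) (hC : 0 < C) (hη : 0 < η) (hα : α < 1 / 2)
    (hUB : ∀ s t : ℝ, s < t →
      MapsRangeWithNormLE U B s t (C * (Real.exp (-η * (t - s)) / (t - s) ^ α))) (t : ℝ) (x : X) :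
    IntegrableOn (fun r => U t r (diffusion B r (ContinuousLinearMap.adjoint (U t r) x)))
      (Iic t) := by
  rw [integrableOn_Iic_iff_integrableOn_Iio]
  have hk := ((integral_kernel_sq C hη hα t).1.mono_set Iio_subset_Iic_self).mul_const
    (‖sqrtDiffusion B t‖ * ‖sqrtDiffusion B t x‖)
  refine Integrable.mono' hk ((aestronglyMeasurable_integrand hU hB t x).mono_set
    Iio_subset_Iic_self) ((ae_restrict_iff' measurableSet_Iio).2 (Eventually.of_forall fun r hr => ?_))
  have hu : 0 < t - r := sub_pos.2 hr
  set k := C * (Real.exp (-η * (t - r)) / (t - r) ^ α)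
  have hk0 : 0 ≤ k := by positivity
  have h1 : ‖backwardNoise U B t r‖ ≤ k * ‖sqrtDiffusion B t‖ :=
    ContinuousLinearMap.opNorm_le_bound _ (by positivity) fun y =>
      (norm_backwardNoise_le hk0 (hUB r t hr) y).trans (by
        rw [mul_assoc k]
        exact mul_le_mul_of_nonneg_left ((sqrtDiffusion B t).le_opNorm y) hk0)
  rw [integrand_eq]
  calc _ ≤ ‖ContinuousLinearMap.adjoint (backwardNoise U B t r)‖ * ‖backwardNoise U B t r x‖ :=
        ContinuousLinearMap.le_opNorm _ _
    _ = ‖backwardNoise U B t r‖ * ‖backwardNoise U B t r x‖ := by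
        rw [show ‖ContinuousLinearMap.adjoint (backwardNoise U B t r)‖ = ‖backwardNoise U B t r‖ from
          LinearIsometryEquiv.norm_map _ _]
    _ ≤ (k * ‖sqrtDiffusion B t‖) * (k * ‖sqrtDiffusion B t x‖) :=
        mul_le_mul h1 (norm_backwardNoise_le hk0 (hUB r t hr) x) (norm_nonneg _) (by positivity)
    _ = k ^ 2 * (‖sqrtDiffusion B t‖ * ‖sqrtDiffusion B t x‖) := by ring

/-- `Q(t,-∞)` as a bounded positive operator, dominated by a multiple of `Q(t)`. -/
lemma exists_covInf_operator (hU : IsEvolutionOperator U)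
    (hB : IsBoundedStronglyContinuous B) (hC : 0 < C) (hη : 0 < η) (hα : α < 1 / 2)
    (hUB : ∀ s t : ℝ, s < t →
      MapsRangeWithNormLE U B s t (C * (Real.exp (-η * (t - s)) / (t - s) ^ α))) (t : ℝ) :
    ∃ Q : X →L[ℝ] X, Q.IsPositive ∧ (∀ x, Q x = covInf U B t x) ∧
      ∀ x, inner ℝ (Q x) x ≤
        C ^ 2 * ((2 * η) ^ (2 * α - 1) * Real.Gamma (1 - 2 * α)) * ‖sqrtDiffusion B t x‖ ^ 2 := by
  have hint := integrableOn_integrand hU hB hC hη hα hUB t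
  have hin : ∀ x y, inner ℝ (covInf U B t x) y =
      ∫ r in Iic t, inner ℝ (backwardNoise U B t r x) (backwardNoise U B t r y) := by
    intro x y
    rw [covInf, real_inner_comm, ← integral_inner (hint x)]
    refine integral_congr_ae (Eventually.of_forall fun r => ?_)
    simp only
    rw [real_inner_comm, inner_integrand]
  have hin_int : ∀ x y, IntegrableOn
      (fun r => inner ℝ (backwardNoise U B t r x) (backwardNoise U B t r y)) (Iic t) := by
    intro x y
    have := (hint x).inner_const (𝕜 := ℝ) y
    simpa only [IntegrableOn, inner_integrand] using this
  have hbound : ∀ x, inner ℝ (covInf U B t x) x ≤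
      C ^ 2 * ((2 * η) ^ (2 * α - 1) * Real.Gamma (1 - 2 * α)) * ‖sqrtDiffusion B t x‖ ^ 2 := by
    intro x
    obtain ⟨hk, hkv⟩ := integral_kernel_sq C hη hα t
    rw [hin, ← hkv, ← integral_mul_const, integral_Iic_eq_integral_Iio,
      integral_Iic_eq_integral_Iio]
    refine setIntegral_mono_on ((hin_int x x).mono_set Iio_subset_Iic_self)
      ((hk.mono_set Iio_subset_Iic_self).mul_const _) measurableSet_Iio fun r hr => ?_
    have hu : 0 < t - r := sub_pos.2 hr
    rw [real_inner_self_eq_norm_sq, ← mul_pow]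
    exact pow_le_pow_left₀ (norm_nonneg _)
      (norm_backwardNoise_le (by positivity) (hUB r t hr) x) 2
  let L : X →ₗ[ℝ] X :=
    { toFun := covInf U B t
      map_add' := fun x y => by
        simp only [covInf, map_add]
        exact integral_add (hint x) (hint y)
      map_smul' := fun c x => by
        simp only [covInf, map_smul, RingHom.id_apply]
        exact integral_smul c _ }
  have hsymm : ∀ x y, inner ℝ (L x) y = inner ℝ x (L y) := fun x y => by
    change inner ℝ (covInf U B t x) y = inner ℝ x (covInf U B t y)
    rw [hin, real_inner_comm, hin]
    simp only [real_inner_comm]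
  -- a symmetric everywhere defined operator is bounded (Hellinger-Toeplitz)
  let Q : X →L[ℝ] X := ⟨L, LinearMap.IsSymmetric.continuous hsymm⟩
  refine ⟨Q, ?_, fun x => rfl, hbound⟩
  rw [ContinuousLinearMap.isPositive_iff]
  refine ⟨hsymm, fun x => ?_⟩
  change 0 ≤ inner ℝ (covInf U B t x) x
  rw [hin]
  exact integral_nonneg fun r => real_inner_self_nonneg

/-- The uniform trace bounds on `Q(t,s)` bound every finite partial sum of the trace of `Q(t,-∞)`, by
letting `s → -∞`. -/
lemma summable_inner_covInf (hUBA : StandingAssumptions U B A) (hC : 0 < C) (hη : 0 < η)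
    (hα : α < 1 / 2) (hUB : ∀ s t : ℝ, s < t →
      MapsRangeWithNormLE U B s t (C * (Real.exp (-η * (t - s)) / (t - s) ^ α))) (t : ℝ) :
    Summable fun i : basisIndex X => inner ℝ (covInf U B t (basis X i)) (basis X i) := by
  have hint := integrableOn_integrand hUBA.evolution hUBA.coeff hC hη hα hUB t
  have hin_int : ∀ x, IntegrableOn (fun r => ‖backwardNoise U B t r x‖ ^ 2) (Iic t) := by
    intro x
    have := (hint x).inner_const (𝕜 := ℝ) x
    simpa only [IntegrableOn, inner_integrand, real_inner_self_eq_norm_sq] using this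
  have hinner : ∀ (S : Set ℝ), S ⊆ Iic t → ∀ x, inner ℝ
      (∫ r in S, U t r (diffusion B r (ContinuousLinearMap.adjoint (U t r) x))) x =
        ∫ r in S, ‖backwardNoise U B t r x‖ ^ 2 := by
    intro S hS x
    rw [real_inner_comm, ← integral_inner ((hint x).mono_set hS)]
    refine integral_congr_ae (Eventually.of_forall fun r => ?_)
    simp only
    rw [real_inner_comm, inner_integrand, real_inner_self_eq_norm_sq]
  set τ := ⨆ s : Iio t, opTrace (cov U B t s)
  refine summable_of_sum_le (c := τ.toReal) (fun i => ?_) fun F => ?_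
  · rw [covInf, hinner _ subset_rfl]
    exact integral_nonneg fun r => sq_nonneg _
  · have hlim : Tendsto (fun s : ℝ => ∑ i ∈ F, ∫ r in s..t,
        ‖backwardNoise U B t r (basis X i)‖ ^ 2) atBot
        (𝓝 (∑ i ∈ F, inner ℝ (covInf U B t (basis X i)) (basis X i))) := by
      refine tendsto_finsetSum _ fun i _ => ?_
      rw [covInf, hinner _ subset_rfl]
      exact intervalIntegral_tendsto_integral_Iic t (hin_int _) tendsto_id
    refine le_of_tendsto hlim ?_
    filter_upwards [eventually_lt_atBot t] with s hs
    have e : ∀ i, inner ℝ (cov U B t s (basis X i)) (basis X i) =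
        ∫ r in s..t, ‖backwardNoise U B t r (basis X i)‖ ^ 2 := fun i => by
      rw [cov, hinner _ Ioc_subset_Iic_self, intervalIntegral.integral_of_le hs.le]
    have h0 : ∀ i, 0 ≤ ∫ r in s..t, ‖backwardNoise U B t r (basis X i)‖ ^ 2 := fun i =>
      intervalIntegral.integral_nonneg hs.le fun r _ => sq_nonneg _
    rw [← ENNReal.ofReal_le_iff_le_toReal (hUBA.trace_bound t).ne,
      ENNReal.ofReal_sum_of_nonneg fun i _ => h0 i]
    calc _ = ∑ i ∈ F, ENNReal.ofReal (inner ℝ (cov U B t s (basis X i)) (basis X i)) := by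
          simp only [e]
      _ ≤ opTrace (cov U B t s) := ENNReal.sum_le_tsum F
      _ ≤ τ := le_iSup (fun s : Iio t => opTrace (cov U B t s)) ⟨s, hs⟩

end CovarianceOperator

/-! ### The evolution system of Gaussian measures -/

section EvolutionSystem

variable {X : Type*} [NormedAddCommGroup X] [InnerProductSpace ℝ X] [CompleteSpace X]

lemma continuous_gradient {f : X → ℝ} (hf : Continuous (fderiv ℝ f)) : Continuous (gradient f) :=
  (InnerProductSpace.toDual ℝ X).symm.continuous.comp hf

lemma norm_gradient (f : X → ℝ) (x : X) : ‖gradient f x‖ = ‖fderiv ℝ f x‖ :=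
  (InnerProductSpace.toDual ℝ X).symm.norm_map _

lemma inner_gradient (f : X → ℝ) (x u : X) : inner ℝ (gradient f x) u = fderiv ℝ f x u := by
  simp [gradient]

variable [TopologicalSpace.SeparableSpace X] [MeasurableSpace X] [BorelSpace X]
  {U : ℝ → ℝ → X →L[ℝ] X} {B : ℝ → X →L[ℝ] X} {A : ℝ → X →ₗ.[ℝ] X} {C η α : ℝ}

/-- The Gaussian measure with covariance `Q(t,-∞)`, and its logarithmic Sobolev inequality with
the energy expressed through `Q(t)^{1/2}`. -/
lemma exists_gaussian_covInf (hUBA : StandingAssumptions U B A) (hC : 0 < C) (hη : 0 < η)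
    (hα : α < 1 / 2) (hUB : ∀ s t : ℝ, s < t →
      MapsRangeWithNormLE U B s t (C * (Real.exp (-η * (t - s)) / (t - s) ^ α))) (t : ℝ) :
    ∃ γ : Measure X, IsGaussianMeasure 0 (covInf U B t) γ ∧ ∀ f : X → ℝ, IsC1bPos f →
      Integrable (fun x => ‖sqrtDiffusion B t (gradient f x)‖ ^ 2 / f x) γ ∧
      (∫ x, f x * Real.log (f x) ∂γ) - (∫ x, f x ∂γ) * Real.log (∫ x, f x ∂γ) ≤
        C ^ 2 / 2 * (2 * η) ^ (2 * α - 1) * Real.Gamma (1 - 2 * α) *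
          ∫ x, ‖sqrtDiffusion B t (gradient f x)‖ ^ 2 / f x ∂γ := by
  have := UniformSpace.secondCountable_of_separable X
  have hcount : Countable (basisIndex X) := HilbertBasis.countable (basis X)
  obtain ⟨Q, hQ, hQc, hQle⟩ := exists_covInf_operator hUBA.evolution hUBA.coeff hC hη hα hUB t
  obtain ⟨hR, -⟩ := posSqrt_spec hQ
  set R := posSqrt Q
  have hRsq : ∀ x, ‖R x‖ ^ 2 = inner ℝ (Q x) x := norm_sq_posSqrt_apply hQ
  have hsum : Summable fun i : basisIndex X => ‖R (basis X i)‖ ^ 2 := by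
    simp only [hRsq, hQc]
    exact summable_inner_covInf hUBA hC hη hα hUB t
  obtain ⟨γ, hγ, hchar, hLS⟩ := exists_gaussian_logSobolev hsum
  refine ⟨γ, ⟨hγ, fun h => ?_⟩, fun f hf => ?_⟩
  · rw [hchar h (inner ℝ (covInf U B t h) h)]
    · simp [neg_div]
    · rw [← hQc, ← hRsq, ← real_inner_self_eq_norm_sq]
      convert! (basis X).hasSum_inner_mul_inner (R h) (R h) using 2 with i
      rw [real_inner_comm (basis X i) (R h), hR.inner_left_eq_inner_right, pow_two]
  · set κ := C ^ 2 * ((2 * η) ^ (2 * α - 1) * Real.Gamma (1 - 2 * α)) with hκ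
    have hcont : Continuous fun x => ‖sqrtDiffusion B t (gradient f x)‖ ^ 2 / f x := by
      have := continuous_gradient hf.continuous_fderiv
      exact ((((sqrtDiffusion B t).continuous.comp this).norm).pow 2).div hf.continuous
        fun x => (hf.pos x).ne'
    have hbdd : ∃ K, ∀ x, |‖sqrtDiffusion B t (gradient f x)‖ ^ 2 / f x| ≤ K := by
      obtain ⟨c, hc, hcf⟩ := hf.lower
      obtain ⟨K, hK⟩ := hf.bounded_deriv
      refine ⟨(‖sqrtDiffusion B t‖ * K) ^ 2 / c, fun x => ?_⟩
      rw [abs_of_nonneg (div_nonneg (sq_nonneg _) (hf.pos x).le)]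
      refine div_le_div₀ (sq_nonneg _) (pow_le_pow_left₀ (norm_nonneg _) ?_ 2) hc (hcf x)
      refine ((sqrtDiffusion B t).le_opNorm _).trans
        (mul_le_mul_of_nonneg_left ?_ (norm_nonneg _))
      rw [norm_gradient]; exact hK x
    refine ⟨integrable_of_continuous_of_bounded hcont hbdd, ?_⟩
    have h := hLS f hf (fun x => κ * (‖sqrtDiffusion B t (gradient f x)‖ ^ 2 / f x))
      (hcont.const_mul κ) ?_ ?_
    · rw [integral_const_mul] at h
      refine h.trans (le_of_eq ?_)
      rw [hκ]; ring
    · obtain ⟨K, hK⟩ := hbdd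
      refine ⟨|κ| * K, fun x => ?_⟩
      rw [abs_mul]
      exact mul_le_mul_of_nonneg_left (hK x) (abs_nonneg _)
    · intro s x
      -- Bessel's inequality for `R ∇f`
      have h1 : ∑ i ∈ s, (fderiv ℝ f x (R (basis X i))) ^ 2 ≤ ‖R (gradient f x)‖ ^ 2 := by
        refine le_trans (le_of_eq ?_)
          ((basis X).orthonormal.sum_inner_products_le (s := s) (R (gradient f x)))
        refine Finset.sum_congr rfl fun i _ => ?_
        rw [← inner_gradient, ← hR.inner_left_eq_inner_right, real_inner_comm, Real.norm_eq_abs,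
          sq_abs]
      rw [← Finset.sum_div, ← mul_div_assoc]
      refine div_le_div_of_nonneg_right (h1.trans ?_) (hf.pos x).le
      rw [hRsq]
      exact hQle _

end EvolutionSystem

/-! ### Powers of `C¹_b` functions -/

section Powers

variable {X : Type*} [NormedAddCommGroup X] [InnerProductSpace ℝ X]

lemma IsC1b.hasFDerivAt_abs_rpow {φ : X → ℝ} (hφ : IsC1b φ) {p : ℝ} (hp : 1 < p) (ε : ℝ) (x : X) :
    HasFDerivAt (fun x => |φ x| ^ p + ε) ((p * |φ x| ^ (p - 2) * φ x) • fderiv ℝ φ x) x :=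
  ((hasDerivAt_abs_rpow (φ x) hp).comp_hasFDerivAt x
    (hφ.contDiff.differentiable one_ne_zero x).hasFDerivAt).add_const ε

lemma IsC1b.isC1bPos_abs_rpow_add {φ : X → ℝ} (hφ : IsC1b φ) {p : ℝ} (hp : 1 < p) {ε : ℝ}
    (hε : 0 < ε) : IsC1bPos fun x => |φ x| ^ p + ε := by
  obtain ⟨M, hM⟩ := hφ.bounded
  obtain ⟨M', hM'⟩ := hφ.bounded_deriv
  refine ⟨?_, ⟨ε, hε, fun x => ?_⟩, ⟨M ^ p + ε, fun x => ?_⟩, ?_⟩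
  · exact (hφ.contDiff.norm_rpow hp).add contDiff_const
  · exact le_add_of_nonneg_left (Real.rpow_nonneg (abs_nonneg _) _)
  · gcongr
    exact hM x
  · have hc : Continuous fun s : ℝ => p * |s| ^ (p - 2) * s := by
      have h := (contDiff_norm_rpow (E := ℝ) hp).continuous_deriv le_rfl
      have e : deriv (fun s : ℝ => ‖s‖ ^ p) = fun s : ℝ => p * |s| ^ (p - 2) * s :=
        funext fun s => (hasDerivAt_abs_rpow s hp).deriv
      rwa [e] at h
    obtain ⟨D, hD⟩ := (isCompact_Icc (a := -M) (b := M)).exists_bound_of_continuousOn hc.continuousOn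
    refine ⟨D * M', fun x => ?_⟩
    rw [(hφ.hasFDerivAt_abs_rpow hp ε x).fderiv, norm_smul]
    have h1 := hD (φ x) (abs_le.1 (hM x))
    exact mul_le_mul h1 (hM' x) (norm_nonneg _) ((norm_nonneg _).trans h1)

/-- A bound on the energy density of `|φ|^p + ε` that is uniform in `ε`. The gradient vanishes where
`φ = 0`, which is why the singularity of `|φ|^{p-2}` for `p < 2` does no harm. -/
lemma IsC1b.energy_abs_rpow_add_le [CompleteSpace X] {φ : X → ℝ} (hφ : IsC1b φ) {p : ℝ}
    (hp : 1 < p) {ε : ℝ} (hε : 0 < ε) (S : X →L[ℝ] X) (x : X) :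
    ‖S (gradient (fun x => |φ x| ^ p + ε) x)‖ ^ 2 / (|φ x| ^ p + ε) ≤
      {x | φ x ≠ 0}.indicator (fun x => p ^ 2 * (|φ x| ^ (p - 2) * ‖S (gradient φ x)‖ ^ 2)) x := by
  have hg : gradient (fun x => |φ x| ^ p + ε) x =
      (p * |φ x| ^ (p - 2) * φ x) • gradient φ x := by
    rw [gradient, (hφ.hasFDerivAt_abs_rpow hp ε x).fderiv, map_smulₛₗ]
    rfl
  rw [hg, map_smul, norm_smul, mul_pow, Real.norm_eq_abs, sq_abs]
  by_cases hx : φ x = 0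
  · rw [indicator_of_notMem (by simpa using hx), hx]
    simp
  · rw [indicator_of_mem (show x ∈ {x | φ x ≠ 0} from hx)]
    have ha : 0 < |φ x| := abs_pos.2 hx
    have e : |φ x| ^ p = |φ x| ^ (p - 2) * φ x ^ 2 := by
      rw [← sq_abs, ← Real.rpow_natCast |φ x| 2, ← Real.rpow_add ha]
      congr 1; push_cast; ring
    have hpos : 0 < |φ x| ^ p := Real.rpow_pos_of_pos ha _
    rw [div_le_iff₀ (by positivity)]
    have h0 : 0 ≤ p ^ 2 * (|φ x| ^ (p - 2) * ‖S (gradient φ x)‖ ^ 2) := by positivity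
    have h1 : (p * |φ x| ^ (p - 2) * φ x) ^ 2 * ‖S (gradient φ x)‖ ^ 2 =
        p ^ 2 * (|φ x| ^ (p - 2) * ‖S (gradient φ x)‖ ^ 2) * |φ x| ^ p := by
      rw [e]; ring
    rw [h1]
    exact mul_le_mul_of_nonneg_left (le_add_of_nonneg_right hε.le) h0

variable [MeasurableSpace X] [BorelSpace X]

/-- The entropy of `|φ|^p + ε` tends to that of `|φ|^p` as `ε → 0`. The convention `Real.log 0 = 0`
makes `y ↦ y log y` continuous at `0`. -/
lemma IsC1b.tendsto_entropy {φ : X → ℝ} (hφ : IsC1b φ) {p : ℝ} (hp : 1 < p) (μ : Measure X)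
    [IsProbabilityMeasure μ] :
    Integrable (fun x => |φ x| ^ p) μ ∧
      Integrable (fun x => |φ x| ^ p * Real.log (|φ x| ^ p)) μ ∧
      Tendsto (fun ε : ℝ => (∫ x, (|φ x| ^ p + ε) * Real.log (|φ x| ^ p + ε) ∂μ) -
          (∫ x, (|φ x| ^ p + ε) ∂μ) * Real.log (∫ x, (|φ x| ^ p + ε) ∂μ)) (𝓝[>] 0)
        (𝓝 ((∫ x, |φ x| ^ p * Real.log (|φ x| ^ p) ∂μ) -
          (∫ x, |φ x| ^ p ∂μ) * Real.log (∫ x, |φ x| ^ p ∂μ))) := by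
  obtain ⟨M, hM⟩ := hφ.bounded
  have hc : Continuous fun x => |φ x| ^ p :=
    hφ.contDiff.continuous.abs.rpow_const fun x => Or.inr (by linarith)
  have hmem : ∀ ε ∈ Icc (0 : ℝ) 1, ∀ x, |φ x| ^ p + ε ∈ Icc 0 (M ^ p + 1) := fun ε hε x =>
    ⟨add_nonneg (Real.rpow_nonneg (abs_nonneg _) _) hε.1,
      add_le_add (Real.rpow_le_rpow (abs_nonneg _) (hM x) (by linarith)) hε.2⟩
  obtain ⟨K, hK⟩ := (isCompact_Icc (a := 0) (b := M ^ p + 1)).exists_bound_of_continuousOn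
    Real.continuous_mul_log.continuousOn
  have hi1 : Integrable (fun x => |φ x| ^ p) μ :=
    integrable_of_continuous_of_bounded hc ⟨M ^ p + 1, fun x => by
      have := hmem 0 (by simp) x
      rw [add_zero] at this
      rw [abs_of_nonneg this.1]; exact this.2⟩
  have hi2 : Integrable (fun x => |φ x| ^ p * Real.log (|φ x| ^ p)) μ :=
    integrable_of_continuous_of_bounded (Real.continuous_mul_log.comp hc) ⟨K, fun x => by
      have := hK _ (hmem 0 (by simp) x)
      rwa [add_zero] at this⟩
  refine ⟨hi1, hi2, Tendsto.sub ?_ ?_⟩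
  · refine tendsto_integral_filter_of_dominated_convergence (fun _ => K) ?_ ?_
      (integrable_const _) ?_
    · exact Eventually.of_forall fun ε =>
        (Real.continuous_mul_log.comp (hc.add_const ε)).aestronglyMeasurable
    · filter_upwards [Ioc_mem_nhdsGT (zero_lt_one' ℝ)] with ε hε
      exact Eventually.of_forall fun x => hK _ (hmem ε ⟨hε.1.le, hε.2⟩ x)
    · refine Eventually.of_forall fun x => ?_
      have : Continuous fun ε : ℝ => (|φ x| ^ p + ε) * Real.log (|φ x| ^ p + ε) :=
        Real.continuous_mul_log.comp (continuous_const.add continuous_id)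
      simpa using (this.tendsto 0).mono_left nhdsWithin_le_nhds
  · have e : ∀ ε : ℝ, ∫ x, (|φ x| ^ p + ε) ∂μ = (∫ x, |φ x| ^ p ∂μ) + ε := fun ε => by
      rw [integral_add hi1 (integrable_const ε)]; simp
    simp only [e]
    have : Continuous fun ε : ℝ => ((∫ x, |φ x| ^ p ∂μ) + ε) *
        Real.log ((∫ x, |φ x| ^ p ∂μ) + ε) :=
      Real.continuous_mul_log.comp (continuous_const.add continuous_id)
    simpa using (this.tendsto 0).mono_left nhdsWithin_le_nhds

end Powers

end OUEvol

theorem theorem6p2 {X : Type*} [NormedAddCommGroup X] [InnerProductSpace ℝ X] [CompleteSpace X]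
    [TopologicalSpace.SeparableSpace X] [MeasurableSpace X] [BorelSpace X]
    (U : ℝ → ℝ → X →L[ℝ] X) (B : ℝ → X →L[ℝ] X) (A : ℝ → X →ₗ.[ℝ] X)
    (hUBA : OUEvol.StandingAssumptions U B A)
    (C η α : ℝ) (hC : 0 < C) (hη : 0 < η) (hα : α ∈ Set.Ico (0 : ℝ) (1 / 2))
    (hU : ∀ s t : ℝ, s < t →
      OUEvol.MapsRangeWithNormLE U B s t (C * (Real.exp (-η * (t - s)) / (t - s) ^ α))) :
    ∃ γ : ℝ → Measure X,
      (∀ t : ℝ, OUEvol.IsGaussianMeasure 0 (OUEvol.covInf U B t) (γ t)) ∧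
      ∀ (φ : X → ℝ), OUEvol.IsC1b φ → ∀ (t p : ℝ), 1 < p →
        Integrable (fun x => |φ x| ^ p) (γ t) ∧
        Integrable (fun x => |φ x| ^ p * Real.log (|φ x| ^ p)) (γ t) ∧
        ENNReal.ofReal
            ((∫ x, |φ x| ^ p * Real.log (|φ x| ^ p) ∂(γ t)) -
              (∫ x, |φ x| ^ p ∂(γ t)) * Real.log (∫ x, |φ x| ^ p ∂(γ t))) ≤
          ENNReal.ofReal
              (C ^ 2 / 2 * (2 * η) ^ (2 * α - 1) * Real.Gamma (1 - 2 * α) * p ^ 2) *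
            ∫⁻ x in {x | φ x ≠ 0},
              ENNReal.ofReal
                (|φ x| ^ (p - 2) * ‖OUEvol.sqrtDiffusion B t (gradient φ x)‖ ^ 2) ∂(γ t) := by
  have := UniformSpace.secondCountable_of_separable X
  choose γ hγ hLS using OUEvol.exists_gaussian_covInf hUBA hC hη hα.2 hU
  refine ⟨γ, hγ, fun φ hφ t p hp => ?_⟩
  have hprob : IsProbabilityMeasure (γ t) := (hγ t).1
  obtain ⟨hi1, hi2, hlim⟩ := hφ.tendsto_entropy hp (γ t)
  refine ⟨hi1, hi2, le_of_tendsto ((ENNReal.continuous_ofReal.tendsto _).comp hlim) ?_⟩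
  filter_upwards [self_mem_nhdsWithin] with ε hε
  obtain ⟨hint, hle⟩ := hLS t _ (hφ.isC1bPos_abs_rpow_add hp hε)
  have hκ : 0 ≤ C ^ 2 / 2 * (2 * η) ^ (2 * α - 1) * Real.Gamma (1 - 2 * α) := by
    have : 0 < Real.Gamma (1 - 2 * α) := Real.Gamma_pos_of_pos (by linarith [hα.2])
    positivity
  have hopen : MeasurableSet {x | φ x ≠ 0} :=
    (isOpen_ne_fun hφ.contDiff.continuous continuous_const).measurableSet
  generalize C ^ 2 / 2 * (2 * η) ^ (2 * α - 1) * Real.Gamma (1 - 2 * α) = κ at hle hκ ⊢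
  refine (ENNReal.ofReal_le_ofReal hle).trans ?_
  rw [ENNReal.ofReal_mul hκ, ENNReal.ofReal_mul hκ, mul_assoc]
  refine mul_le_mul' le_rfl ?_
  rw [ofReal_integral_eq_lintegral_ofReal hint (Eventually.of_forall fun x =>
      div_nonneg (sq_nonneg _) ((hφ.isC1bPos_abs_rpow_add hp hε).pos x).le),
    ← lintegral_const_mul' _ _ ENNReal.ofReal_ne_top, ← lintegral_indicator hopen]
  refine lintegral_mono fun x => ?_
  refine (ENNReal.ofReal_le_ofReal (hφ.energy_abs_rpow_add_le hp hε _ x)).trans (le_of_eq ?_)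
  by_cases hx : x ∈ {x | φ x ≠ 0}
  · rw [indicator_of_mem hx, indicator_of_mem hx, ENNReal.ofReal_mul (sq_nonneg p)]
  · rw [indicator_of_notMem hx, indicator_of_notMem hx, ENNReal.ofReal_zero]
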